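/- An oriented flat-virtual link diagram is a finite four-valent plane graph, possibly with crossingless closed curves, each of whose vertices is classical (with one of the two strands through it marked as the overcrossing strand), flat or virtual, and which is obtained from an immersion of oriented circles (opposite edges at a vertex form a strand). Oriented flat-virtual links are the classes of such diagrams, considered up to isotopy, under the equivalence relation generated by the following moves, with all orientations of strands: (1) the three classical Reidemeister moves on classical crossings; (2) the second and third Reidemeister moves on flat crossings; (3) the third Reidemeister move on one classical and two flat crossings, in which a strand with two consecutive flat crossings passes through the classical crossing, whose over-under structure is preserved; (4) detour moves: a strand all of whose crossings, with other strands and with itself, are virtual is replaced by another such strand with the same endpoints, the rest of the diagram being unchanged. For a diagram $D$ let $C(D)$ be its set of classical crossings and $w(D)=\sum_{c\in C(D)}w(c)$ its writhe, where $w(c)=\pm1$ is the usual sign of the crossing $c$. A state is a map $s\colon C(D)\to\{0,1\}$. Its smoothing $D_s$ is obtained by smoothing every $c\in C(D)$: for $s(c)=0$ the two regions swept out by the overcrossing strand when it is rotated counterclockwise are joined, for $s(c)=1$ the two other regions are joined. (So the smoothing at $c$ is the one compatible with the orientation if and only if $s(c)=0$ and $w(c)=1$, or $s(c)=1$ and $w(c)=-1$.)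 Put $\alpha(s)=\#\{c\mid s(c)=0\}$ and $\beta(s)=\#\{c\mid s(c)=1\}$, and let $\gamma_{even}(s)$, $\gamma_{odd}(s)$ be the numbers of unicursal components of $D_s$ (the curve going straight ahead at flat and virtual vertices) that pass through an even, respectively odd, number of flat crossings; a flat self-crossing of a component is counted once, and a flat crossing of two different components is counted for both of them. The flat-virtual Jones polynomial of $D$ is $$X(D)=(-a)^{-3w(D)}\sum_{s}a^{\alpha(s)-\beta(s)}(-a^2-a^{-2})^{\gamma_{even}(s)}\,b^{\gamma_{odd}(s)}\in\mathbb Z[a,a^{-1},b].$$ Theorem. If two oriented flat-virtual link diagrams $D,D'$ differ by one of the moves above, then $X(D)=X(D')$. Consequently $X$ is a well-defined invariant of oriented flat-virtual links. -/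

import Mathlib

namespace FlatVirtual

/-- The type of a vertex of an oriented diagram.  Near a vertex, turn the picture so that both
strands run upwards: one strand runs from the lower left to the upper right (it is called
`false`), the other one from the lower right to the upper left (it is called `true`).
`classical o` is a classical crossing whose overcrossing strand is the strand `o`. -/
inductive Kind where
  | classical (overStrand : Bool)
  | flat
  | virtual

namespace Kind

def isClassical : Kind → Bool
  | classical _ => true
  | flat => false
  | virtual => false

/-- The local writhe: a classical crossing is positive when the strand running to the upper
right is the overcrossing one. -/
def sign : Kind → ℤ
  | classical false => 1
  | classical true => -1
  | flat => 0
  | virtual => 0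

end Kind

/-- A finite four-valent oriented graph in which opposite edges at each vertex form a strand, with
a cyclic order of the edges at each vertex (a rotation system) and vertex types; crossingless
closed curves are counted by `circles`.  It is drawn on some closed oriented surface; for plane
diagrams see `IsPlanar`.

A pair `(v, x) : V × Bool` is the passage of strand `x` through the vertex `v` (strands `false`
and `true` as in `Kind`).  Leaving `v` along strand `x`, the next passage is `next (v, x)`.
Hence the cycles of `next` are the unicursal components having crossings. -/
structure SurfaceDiagram where
  V : Type
  [fintypeV : Fintype V]
  [decidableEqV : DecidableEq V]
  kind : V → Kind
  next : Equiv.Perm (V × Bool)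
  circles : ℕ

attribute [instance] SurfaceDiagram.fintypeV SurfaceDiagram.decidableEqV

namespace SurfaceDiagram

abbrev Passage (D : SurfaceDiagram) : Type := D.V × Bool

/-! ### Half-edges, faces, planarity -/

/-- Half-edges: `(p, true)` is the end of the edge going out of the passage `p` and `(p, false)`
is the end of the edge coming into `p`, both at the vertex `p.1`. -/
abbrev HalfEdge (D : SurfaceDiagram) : Type := D.Passage × Bool

/-- The next half-edge counterclockwise around the same vertex.  The counterclockwise order is:
upper right (`false`, outgoing), upper left (`true`, outgoing), lower left (`false`, incoming),
lower right (`true`, incoming). -/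
def rot (D : SurfaceDiagram) : Equiv.Perm D.HalfEdge where
  toFun h := match h with
    | ((v, false), o) => ((v, true), o)
    | ((v, true), o) => ((v, false), !o)
  invFun h := match h with
    | ((v, false), o) => ((v, true), !o)
    | ((v, true), o) => ((v, false), o)
  left_inv := by rintro ⟨⟨v, _ | _⟩, o⟩ <;> simp
  right_inv := by rintro ⟨⟨v, _ | _⟩, o⟩ <;> simp

/-- The other half of the same edge. -/
def opp (D : SurfaceDiagram) : Equiv.Perm D.HalfEdge where
  toFun h := match h with
    | (p, true) => (D.next p, false)
    | (p, false) => (D.next.symm p, true)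
  invFun h := match h with
    | (p, true) => (D.next p, false)
    | (p, false) => (D.next.symm p, true)
  left_inv := by rintro ⟨p, _ | _⟩ <;> simp
  right_inv := by rintro ⟨p, _ | _⟩ <;> simp

/-- Walking along the boundary of a face: go to the other end of the edge, then turn. The cycles
of this permutation are the faces. -/
def face (D : SurfaceDiagram) : Equiv.Perm D.HalfEdge := D.opp.trans D.rot

abbrev Faces (D : SurfaceDiagram) : Type := Quotient (Equiv.Perm.SameCycle.setoid D.face)

/-- The connected components of the underlying graph (crossingless circles excluded). -/
abbrev GraphComponents (D : SurfaceDiagram) : Type :=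
  Quot fun v w : D.V => ∃ x y, D.next (v, x) = (w, y)

/-- Every connected component of the graph has genus `0`, i.e. is drawn on the sphere (plane):
Euler's formula `|V| - |E| + |F| = 2 * |components|`, where `|E| = 2 * |V|`. -/
def IsPlanar (D : SurfaceDiagram) : Prop :=
  Nat.card D.Faces = Nat.card D.V + 2 * Nat.card D.GraphComponents

/-! ### Isomorphism and erasing of vertices -/

structure Iso (D D' : SurfaceDiagram) where
  equiv : D.V ≃ D'.V
  kind_eq : ∀ v, D'.kind (equiv v) = D.kind v
  next_eq : ∀ v x w y, D.next (v, x) = (w, y) → D'.next (equiv v, x) = (equiv w, y)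
  circles_eq : D'.circles = D.circles

/-- `D'` is obtained from `D` by erasing the vertices of `S`, each strand through an erased vertex
being continued straight ahead.  A unicursal component all of whose vertices are erased
becomes a crossingless circle. -/
structure Erasure (D : SurfaceDiagram) (S : Set D.V) (D' : SurfaceDiagram) where
  equiv : D'.V ≃ {v : D.V // v ∉ S}
  kind_eq : ∀ v, D'.kind v = D.kind (equiv v)
  next_eq : ∀ v x w y, D'.next (v, x) = (w, y) →
    ∃ n : ℕ, (D.next ^ (n + 1)) ((equiv v : D.V), x) = ((equiv w : D.V), y) ∧
      ∀ j < n, ((D.next ^ (j + 1)) ((equiv v : D.V), x)).1 ∈ S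
  circles_eq : D'.circles = D.circles +
    Nat.card {c : Quotient (Equiv.Perm.SameCycle.setoid D.next) //
      ∀ p : D.Passage, Quotient.mk _ p = c → p.1 ∈ S}

/-! ### Reidemeister moves -/

/-- The vertex at which a half-edge is attached. -/
def vertex (D : SurfaceDiagram) (h : D.HalfEdge) : D.V := h.1.1

/-- The half-edge `h` belongs to the overcrossing strand of a classical crossing. -/
def IsOver (D : SurfaceDiagram) (h : D.HalfEdge) : Prop :=
  D.kind (D.vertex h) = Kind.classical h.1.2

/-- The vertex of `h` is a classical crossing, and `h` belongs to its undercrossing strand. -/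
def IsUnder (D : SurfaceDiagram) (h : D.HalfEdge) : Prop :=
  D.kind (D.vertex h) = Kind.classical (!h.1.2)

/-- `h` spans a face with one corner. -/
def IsMonogon (D : SurfaceDiagram) (h : D.HalfEdge) : Prop := D.face h = h

/-- `h` and `face h` span a face with two corners, which are different vertices. -/
def IsBigon (D : SurfaceDiagram) (h : D.HalfEdge) : Prop :=
  D.face (D.face h) = h ∧ D.vertex h ≠ D.vertex (D.face h)

/-- `h`, `face h`, `face (face h)` span a face with three corners, which are different
vertices. -/
def IsTriangle (D : SurfaceDiagram) (h : D.HalfEdge) : Prop :=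
  D.face (D.face (D.face h)) = h ∧ D.vertex h ≠ D.vertex (D.face h) ∧
    D.vertex (D.face h) ≠ D.vertex (D.face (D.face h)) ∧
    D.vertex (D.face (D.face h)) ≠ D.vertex h

/-- Interchange the two passages joined by the edge of `h`. -/
def edgeSwap (D : SurfaceDiagram) (h : D.HalfEdge) : Equiv.Perm D.Passage :=
  Equiv.swap h.1 (D.opp h).1

/-- The third Reidemeister move at the triangle of `h`: on each of its three strands the two
consecutive crossings of the triangle are passed in the opposite order; the three crossings
themselves (their types and the directions of their strands) are preserved. -/
def slide (D : SurfaceDiagram) (h : D.HalfEdge) : SurfaceDiagram where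
  V := D.V
  kind := D.kind
  next :=
    let τ := D.edgeSwap h * D.edgeSwap (D.face h) * D.edgeSwap (D.face (D.face h))
    τ * D.next * τ⁻¹
  circles := D.circles

/-- `D'` is obtained from `D` by removing a classical curl. -/
def ClassicalR1 (D D' : SurfaceDiagram) : Prop :=
  ∃ h, D.IsMonogon h ∧ (D.kind (D.vertex h)).isClassical = true ∧
    Nonempty (Erasure D {D.vertex h} D')

/-- `D'` is obtained from `D` by removing a bigon with classical corners, one of whose sides is
over (and the other one under) at both corners. -/
def ClassicalR2 (D D' : SurfaceDiagram) : Prop :=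
  ∃ h, D.IsBigon h ∧ D.IsOver h ∧ D.IsOver (D.opp h) ∧
    Nonempty (Erasure D {D.vertex h, D.vertex (D.face h)} D')

/-- Third Reidemeister move with three classical crossings: one side of the triangle is over at
both of its ends, one side is under at both of its ends. -/
def ClassicalR3 (D D' : SurfaceDiagram) : Prop :=
  ∃ h, D.IsTriangle h ∧
    (D.kind (D.vertex h)).isClassical = true ∧
    (D.kind (D.vertex (D.face h))).isClassical = true ∧
    (D.kind (D.vertex (D.face (D.face h)))).isClassical = true ∧
    (D.IsOver h ∧ D.IsOver (D.opp h)) ∧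
    (∃ g, (g = D.face h ∨ g = D.face (D.face h)) ∧ D.IsUnder g ∧ D.IsUnder (D.opp g)) ∧
    Nonempty (Iso (D.slide h) D')

/-- `D'` is obtained from `D` by removing a bigon with flat corners. -/
def FlatR2 (D D' : SurfaceDiagram) : Prop :=
  ∃ h, D.IsBigon h ∧
    D.kind (D.vertex h) = Kind.flat ∧ D.kind (D.vertex (D.face h)) = Kind.flat ∧
    Nonempty (Erasure D {D.vertex h, D.vertex (D.face h)} D')

/-- Third Reidemeister move with three flat crossings. -/
def FlatR3 (D D' : SurfaceDiagram) : Prop :=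
  ∃ h, D.IsTriangle h ∧
    D.kind (D.vertex h) = Kind.flat ∧
    D.kind (D.vertex (D.face h)) = Kind.flat ∧
    D.kind (D.vertex (D.face (D.face h))) = Kind.flat ∧
    Nonempty (Iso (D.slide h) D')

/-- A strand (containing the edge of `h`) with two consecutive flat crossings passes through a
classical crossing. -/
def MixedR3 (D D' : SurfaceDiagram) : Prop :=
  ∃ h, D.IsTriangle h ∧
    D.kind (D.vertex h) = Kind.flat ∧
    D.kind (D.vertex (D.face h)) = Kind.flat ∧
    (D.kind (D.vertex (D.face (D.face h)))).isClassical = true ∧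
    Nonempty (Iso (D.slide h) D')

/-! ### The detour move -/

/-- The vertices met by the strand that starts just after the passage `p` and ends just after the
`n`-th following passage. -/
def strandVertices (D : SurfaceDiagram) (p : D.Passage) (n : ℕ) : Set D.V :=
  {v | ∃ j, 1 ≤ j ∧ j ≤ n ∧ ((D.next ^ j) p).1 = v}

/-- A place where a strand can be put: `some q` is the edge leaving the passage `q`, and `none`
is a crossingless circle. -/
abbrev Place (E : SurfaceDiagram) : Type := Option E.Passage

/-- In `D` there is a strand all of whose crossings (with other strands and with itself) are
virtual; when the crossings on this strand are erased, the rest of `D` becomes the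
diagram `E`, in which the strand has to be put back at the place `a`.  In the first case the
strand is a crossingless piece of a crossingless circle. -/
def HasVirtualStrand (D E : SurfaceDiagram) (a : E.Place) : Prop :=
  (a = none ∧ 0 < D.circles ∧ Nonempty (Iso D E)) ∨
  ∃ (p : D.Passage) (n : ℕ),
    (∀ v ∈ D.strandVertices p n, D.kind v = Kind.virtual) ∧
    ∃ e : Erasure D (D.strandVertices p n) E,
      match a with
      | some q => ∃ m : ℕ, (D.next ^ m) ((e.equiv q.1 : D.V), q.2) = p ∧
          ∀ j, 1 ≤ j → j ≤ m →
            ((D.next ^ j) ((e.equiv q.1 : D.V), q.2)).1 ∈ D.strandVertices p n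
      | none => ∀ r : D.Passage, D.next.SameCycle p r → r.1 ∈ D.strandVertices p n

/-- The detour move: a strand with only virtual crossings is removed and replaced by another strand
with the same ends, all of whose crossings are virtual. -/
def Detour (D D' : SurfaceDiagram) : Prop :=
  ∃ (E : SurfaceDiagram) (a : E.Place), D.HasVirtualStrand E a ∧ D'.HasVirtualStrand E a

/-! ### Smoothings -/

/-- The set `C(D)` of classical crossings. -/
abbrev ClassicalCrossing (D : SurfaceDiagram) : Type :=
  {v : D.V // (D.kind v).isClassical = true}

/-- A state assigns `0` (`false`) or `1` (`true`) to every classical crossing. -/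
abbrev State (D : SurfaceDiagram) : Type := D.ClassicalCrossing → Bool

/-- The number of classical crossings with `s c = 0`. -/
def alpha {D : SurfaceDiagram} (s : D.State) : ℕ := Fintype.card {c // s c = false}

/-- The number of classical crossings with `s c = 1`. -/
def beta {D : SurfaceDiagram} (s : D.State) : ℕ := Fintype.card {c // s c = true}

/-- The edges of `D` that become joined at a vertex of the smoothing `D_s`.  An edge is
named by the passage which it leaves, so the edge coming into the passage `p` is `next.symm p`.

At flat and virtual vertices the strands go straight ahead.  The `0`-smoothing of a classical
crossing joins the two regions swept out by the overcrossing strand when it is turned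
counterclockwise, the `1`-smoothing joins the other two regions.  So the `0`-smoothing of a positive
crossing (`classical false`) and the `1`-smoothing of a negative one (`classical true`) are the
smoothings that respect the orientation, and the others are not. -/
inductive Joined (D : SurfaceDiagram) (s : D.State) : D.Passage → D.Passage → Prop
  | straight (v : D.V) (x : Bool) (h : (D.kind v).isClassical = false) :
      Joined D s (D.next.symm (v, x)) (v, x)
  | oriented (c : D.ClassicalCrossing) (x : Bool) (h : D.kind c = Kind.classical (s c)) :
      Joined D s (D.next.symm (c, x)) (c, !x)
  | disoriented_in (c : D.ClassicalCrossing) (h : D.kind c = Kind.classical (!(s c))) :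
      Joined D s (D.next.symm (c, false)) (D.next.symm (c, true))
  | disoriented_out (c : D.ClassicalCrossing) (h : D.kind c = Kind.classical (!(s c))) :
      Joined D s (c, false) (c, true)

/-- The components of the smoothing `D_s`, other than the crossingless circles of `D`. -/
abbrev StateComponent {D : SurfaceDiagram} (s : D.State) : Type := Quot (D.Joined s)

/-- The number of flat crossings on a component of the smoothing: of flat vertices through which it
passes at least once, so that a self-crossing is counted once. -/
noncomputable def flatCount {D : SurfaceDiagram} (s : D.State) (c : StateComponent s) : ℕ :=
  Nat.card {v : D.V // D.kind v = Kind.flat ∧ ∃ x, Quot.mk (D.Joined s) (v, x) = c}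

noncomputable def gammaEven {D : SurfaceDiagram} (s : D.State) : ℕ :=
  Nat.card {c : StateComponent s // Even (flatCount s c)} + D.circles

noncomputable def gammaOdd {D : SurfaceDiagram} (s : D.State) : ℕ :=
  Nat.card {c : StateComponent s // Odd (flatCount s c)}

def writhe (D : SurfaceDiagram) : ℤ := ∑ c : D.ClassicalCrossing, (D.kind c).sign

end SurfaceDiagram

/-! ### Flat-virtual links -/

/-- Oriented flat-virtual link diagrams in the plane. -/
def Diagram : Type 1 := {D : SurfaceDiagram // D.IsPlanar}

/-- The moves (each of them in one of its two directions). -/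
inductive Move (D D' : Diagram) : Prop
  | isotopy (h : Nonempty (SurfaceDiagram.Iso D.1 D'.1))
  | classicalR1 (h : D.1.ClassicalR1 D'.1)
  | classicalR2 (h : D.1.ClassicalR2 D'.1)
  | classicalR3 (h : D.1.ClassicalR3 D'.1)
  | flatR2 (h : D.1.FlatR2 D'.1)
  | flatR3 (h : D.1.FlatR3 D'.1)
  | mixedR3 (h : D.1.MixedR3 D'.1)
  | detour (h : D.1.Detour D'.1)

/-- Oriented flat-virtual links: classes of diagrams under the equivalence relation generated by
the moves. -/
def Link : Type 1 := Quot Move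

def Diagram.toLink (D : Diagram) : Link := Quot.mk Move D

/-! ### The flat-virtual Jones polynomial -/

/-- The ring `ℤ[a, a⁻¹, b]`. -/
abbrev CoeffRing : Type := Polynomial (LaurentPolynomial ℤ)

/-- The variable `a`, as an invertible element. -/
noncomputable def a : CoeffRingˣ where
  val := Polynomial.C (LaurentPolynomial.T 1)
  inv := Polynomial.C (LaurentPolynomial.T (-1))
  val_inv := by rw [← Polynomial.C_mul, ← LaurentPolynomial.T_add]; simp
  inv_val := by rw [← Polynomial.C_mul, ← LaurentPolynomial.T_add]; simp

/-- The variable `b`. -/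
noncomputable def b : CoeffRing := Polynomial.X

open SurfaceDiagram in
noncomputable def jones (D : Diagram) : CoeffRing :=
  (((-a) ^ (-3 * D.1.writhe) : CoeffRingˣ) : CoeffRing) *
    ∑ s : D.1.State,
      ((a ^ ((alpha s : ℤ) - (beta s : ℤ)) : CoeffRingˣ) : CoeffRing) *
        (-((a ^ (2 : ℤ) : CoeffRingˣ) : CoeffRing) - ((a ^ (-2 : ℤ) : CoeffRingˣ) : CoeffRing)) ^
          gammaEven s *
        b ^ gammaOdd s

end FlatVirtual

namespace FlatVirtual

/-! The proof is Kauffman's state-sum argument made local, with parities of flat crossings carried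
along. `jones_eq` writes the polynomial as a power of `-a` times `bracket`, a sum over all
resolutions of all vertices (straight ahead or one of two smoothings), in which inadmissible choices
have weight 0. The monomial of a state becomes `stateValue`, a product over classes of linked
half-edges. Diagrams can therefore be compared through bijections of classes that respect the flat
vertices met.

Virtual vertices may be erased (`Erasure.bracket_eq`): components keep their flat vertices, and a
component that is erased completely turns into a crossingless circle of the same value. This settles
the detour move, since both diagrams erase to the same one. It also allows the vertices of a removed
curl or bigon to be made virtual first, so that the underlying graph stays fixed and only vertex
types change.

In the other moves the resolution outside a small polygon is fixed (`Polygon.sum_congr`) and the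
sides of the polygon are contracted to points (`Polygon.stateValue_eq`). Each choice at the corners
then just matches the outer ends, possibly with one closed loop in addition. With `δ = loopValue`, a
positive curl gives `aδ + a⁻¹ = -a³`, a negative one gives `-a⁻³`, and the writhe factor absorbs
both. In the second move the unwanted matching has coefficient `δ + a² + a⁻² = 0`. In the third move
this same cancellation leaves expressions that are symmetric under the slide.

For flat moves the parities matter. The corners of a flat bigon meet the same components, so
together they change no parity. Sliding a flat triangle leaves every strand with the same crossings.
In the mixed move one smoothing of the classical corner makes the two flat corners meet the same
components, and the other smoothing makes the slide interchange the two flat vertices. -/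

/-- The value `-a² - a⁻²` of a circle. -/
noncomputable def loopValue : CoeffRing :=
  -((a ^ (2 : ℤ) : CoeffRingˣ) : CoeffRing) - ((a ^ (-2 : ℤ) : CoeffRingˣ) : CoeffRing)

/-! ### Products over the classes of a relation, weighted by parity -/

section StateValue

variable {H H' V V' L : Type}

/-- The class `c` meets the marking of the vertex `v`. -/
def Meets (r : H → H → Prop) (m : V → Set H) (v : V) (c : Quot r) : Prop :=
  ∃ x ∈ m v, Quot.mk r x = c

/-- The product over the classes of `r` of `loopValue` for those meeting an even number of marked
vertices, and of `b` for the other ones. -/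
noncomputable def stateValue (r : H → H → Prop) (m : V → Set H) : CoeffRing :=
  open Classical in
  ∏ᶠ c : Quot r, if Even (Nat.card {v // Meets r m v c}) then loopValue else b

/-- The classes indexed by `L` are the extra closed curves. They meet no marked vertex, and zero is
even, so each contributes `loopValue`. -/
theorem stateValue_eq_of_bijective [Finite H] [Finite H'] [Finite L]
    {r : H → H → Prop} {m : V → Set H} {r' : H' → H' → Prop} {m' : V' → Set H'}
    (ι : V' → V) (hι : Function.Injective ι) (F : Quot r' ⊕ L → Quot r) (hF : Function.Bijective F)
    (hm : ∀ v c, Meets r m (ι v) (F (Sum.inl c)) ↔ Meets r' m' v c)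
    (hout : ∀ v ∉ Set.range ι, m v = ∅)
    (hL : ∀ v l, ¬ Meets r m v (F (Sum.inr l))) :
    stateValue r m = stateValue r' m' * loopValue ^ Nat.card L := by
  classical
  have : Finite (Quot r') := Quot.finite _
  have := Fintype.ofFinite (Quot r')
  have := Fintype.ofFinite L
  unfold stateValue
  rw [← finprod_eq_of_bijective F hF (fun _ => rfl), finprod_eq_prod_of_fintype,
    Fintype.prod_sum_type, finprod_eq_prod_of_fintype]
  congr 1
  · refine Finset.prod_congr rfl fun c _ => ?_
    have : Nat.card {v // Meets r m v (F (Sum.inl c))} = Nat.card {v // Meets r' m' v c} := by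
      symm
      refine Nat.card_eq_of_bijective (fun v => ⟨ι v.1, (hm _ _).2 v.2⟩) ⟨?_, ?_⟩
      · intro v w h
        exact Subtype.ext (hι (congrArg Subtype.val h))
      · rintro ⟨v, hv⟩
        by_cases h : v ∈ Set.range ι
        · obtain ⟨w, rfl⟩ := h
          exact ⟨⟨w, (hm _ _).1 hv⟩, rfl⟩
        · obtain ⟨x, hx, -⟩ := hv
          rw [hout v h] at hx
          exact hx.elim
    rw [this]
  · rw [Finset.prod_congr rfl (g := fun _ => loopValue), Finset.prod_const, Finset.card_univ,
      Nat.card_eq_fintype_card]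
    intro l _
    have : IsEmpty {v // Meets r m v (F (Sum.inr l))} := ⟨fun v => hL v.1 l v.2⟩
    simp

/-- The bijection on classes induced by a surjection compatible with the relations. -/
theorem bijective_quotMap {r : H → H → Prop} {r' : H' → H' → Prop} (φ : H → H')
    (hφ : Function.Surjective φ)
    (h1 : ∀ x y, r x y → Quot.mk r' (φ x) = Quot.mk r' (φ y))
    (h2 : ∀ x y, φ x = φ y → Quot.mk r x = Quot.mk r y)
    (h3 : ∀ u w, r' u w → ∃ x y, φ x = u ∧ φ y = w ∧ Quot.mk r x = Quot.mk r y) :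
    Function.Bijective (Quot.lift (fun x => Quot.mk r' (φ x)) h1) := by
  constructor
  -- A section of `φ` descends to a left inverse: by `h2` the choice of preimage is immaterial, and
  -- by `h3` the generators of `r'` come from identifications made by `r`.
  · have key : ∀ u w, r' u w →
        Quot.mk r (Function.surjInv hφ u) = Quot.mk r (Function.surjInv hφ w) := by
      intro u w h
      obtain ⟨x, y, rfl, rfl, hxy⟩ := h3 u w h
      rw [h2 _ x (Function.surjInv_eq hφ _), hxy, h2 _ y (Function.surjInv_eq hφ _)]
    apply Function.LeftInverse.injective (g := Quot.lift (fun u => Quot.mk r _) key)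
    rintro ⟨x⟩
    exact h2 _ _ (Function.surjInv_eq hφ _)
  · rintro ⟨u⟩
    obtain ⟨x, rfl⟩ := hφ u
    exact ⟨Quot.mk r x, rfl⟩

/-- The form used most often: `φ` may contract points that are already equivalent, and marks need to
agree only up to equivalence, because only the classes met are counted. -/
theorem stateValue_eq_of_surjective [Finite H] [Finite H']
    {r : H → H → Prop} {m : V → Set H} {r' : H' → H' → Prop} {m' : V' → Set H'}
    (π : V ≃ V') (φ : H → H')
    (hφ : Function.Surjective φ)
    (h1 : ∀ x y, r x y → Quot.mk r' (φ x) = Quot.mk r' (φ y))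
    (h2 : ∀ x y, φ x = φ y → Quot.mk r x = Quot.mk r y)
    (h3 : ∀ u w, r' u w → ∃ x y, φ x = u ∧ φ y = w ∧ Quot.mk r x = Quot.mk r y)
    (hm : ∀ v, ∀ x ∈ m v, ∃ y ∈ m' (π v), Quot.mk r' (φ x) = Quot.mk r' y)
    (hm' : ∀ v, ∀ y ∈ m' (π v), ∃ x ∈ m v, Quot.mk r' (φ x) = Quot.mk r' y) :
    stateValue r m = stateValue r' m' := by
  have hb := bijective_quotMap φ hφ h1 h2 h3
  have := stateValue_eq_of_bijective (L := Empty) (r := r') (m := m') (r' := r) (m' := m) π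
    π.injective (Sum.elim (Quot.lift (fun x => Quot.mk r' (φ x)) h1) Empty.elim) ?_ ?_ ?_ ?_
  · simpa using this.symm
  · constructor
    · rintro (x | x) (y | y) h
      · exact congrArg _ (hb.1 h)
      all_goals exact Empty.elim (by assumption)
    · intro c
      obtain ⟨x, hx⟩ := hb.2 c
      exact ⟨Sum.inl x, hx⟩
  · rintro v c
    constructor
    · rintro ⟨y, hy, h⟩
      obtain ⟨x, hx, hxy⟩ := hm' v y hy
      refine ⟨x, hx, hb.1 ?_⟩
      exact hxy.trans h
    · rintro ⟨x, hx, rfl⟩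
      obtain ⟨y, hy, hxy⟩ := hm v x hx
      exact ⟨y, hy, hxy.symm⟩
  · intro v hv
    exact (hv (π.surjective v)).elim
  · rintro v ⟨⟩

/-- Two vertices meeting the same classes may be unmarked. -/
theorem stateValue_unmark [Finite V] {r : H → H → Prop} {m m' : V → Set H} {v w : V}
    (hvw : v ≠ w) (h : ∀ c, Meets r m v c ↔ Meets r m w c)
    (hv : m' v = ∅) (hw : m' w = ∅) (hm : ∀ u, u ≠ v → u ≠ w → m u = m' u) :
    stateValue r m = stateValue r m' := by
  classical
  unfold stateValue
  refine finprod_congr fun c => ?_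
  have := Fintype.ofFinite V
  have h' : ∀ u, Meets r m' u c ↔ Meets r m u c ∧ u ≠ v ∧ u ≠ w := by
    intro u
    by_cases h1 : u = v
    · subst h1; simp [Meets, hv]
    by_cases h2 : u = w
    · subst h2; simp [Meets, hw]
    simp [Meets, hm u h1 h2, h1, h2]
  have : Even (Nat.card {u // Meets r m u c}) ↔ Even (Nat.card {u // Meets r m' u c}) := by
    simp only [Nat.card_eq_fintype_card, Fintype.card_subtype, h']
    have e : (Finset.univ.filter fun u => Meets r m u c ∧ u ≠ v ∧ u ≠ w) =
        ((Finset.univ.filter fun u => Meets r m u c).erase v).erase w := by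
      ext u; simp; tauto
    rw [e]
    -- A class meets both `v` and `w` or neither, so its count drops by two or not at all.
    by_cases hc : Meets r m v c
    · have hc' := (h c).1 hc
      have h1 : v ∈ Finset.univ.filter fun u => Meets r m u c := by simpa using hc
      have h2 : w ∈ (Finset.univ.filter fun u => Meets r m u c).erase v := by
        simpa using ⟨hvw.symm, hc'⟩
      have e1 := Finset.card_erase_add_one h1
      have e2 := Finset.card_erase_add_one h2
      rw [← e1, ← e2]
      simp [Nat.even_add_one]
    · have hc' := fun h0 => hc ((h c).2 h0)
      rw [Finset.erase_eq_of_notMem (a := v) (by simpa using hc),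
        Finset.erase_eq_of_notMem (by simpa using hc')]
  simp only [this]

end StateValue

/-! ### The polynomial as a sum over resolutions of all vertices -/

namespace SurfaceDiagram

variable (D : SurfaceDiagram)

/-- A resolution of a vertex: `none` goes straight ahead, `some false` is the smoothing that
respects the orientation, `some true` is the other one. -/
abbrev Resolution : Type := Option Bool

/-- The half-edge to which a half-edge is joined at its vertex. -/
def turn {V : Type} (ρ : V → Resolution) (h : (V × Bool) × Bool) : (V × Bool) × Bool :=
  match ρ h.1.1 with
  | none => (h.1, !h.2)
  | some d => ((h.1.1, !h.1.2), xor (!h.2) d)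

/-- The half-edges joined along an edge or at a vertex. -/
def Linked (ρ : D.V → Resolution) (x y : D.HalfEdge) : Prop :=
  y = D.opp x ∨ y = turn ρ x

/-- The half-edges at a flat vertex. -/
def flatMarks {V : Type} (κ : V → Kind) (v : V) : Set ((V × Bool) × Bool) :=
  {h | κ v = Kind.flat ∧ h.1.1 = v}

/-- The coefficient of a resolution of a vertex. -/
noncomputable def weight : Kind → Resolution → CoeffRing
  | .classical _, none => 0
  | .classical o, some d => if o = d then (a : CoeffRing) else ((a⁻¹ : CoeffRingˣ) : CoeffRing)
  | .flat, none => 1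
  | .flat, some _ => 0
  | .virtual, none => 1
  | .virtual, some _ => 0

/-- The unnormalized state sum. -/
noncomputable def bracket : CoeffRing :=
  loopValue ^ D.circles *
    ∑ ρ : D.V → Resolution, (∏ v, weight (D.kind v) (ρ v)) *
      stateValue (D.Linked ρ) (flatMarks D.kind)

theorem writhe_eq_sum : D.writhe = ∑ v, (D.kind v).sign := by
  unfold writhe
  rw [← Finset.sum_subtype (Finset.univ.filter fun v => (D.kind v).isClassical = true)
    (by simp) (fun v => (D.kind v).sign), Finset.sum_filter]
  refine Finset.sum_congr rfl fun v _ => ?_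
  cases D.kind v <;> simp [Kind.isClassical, Kind.sign]

/-- The overcrossing strand of a classical crossing. -/
def overStrand : Kind → Bool
  | .classical o => o
  | .flat => false
  | .virtual => false

variable {D}

/-- The resolution given by a state. -/
def resolution (s : D.State) (v : D.V) : Resolution :=
  if h : (D.kind v).isClassical = true then
    some (xor (overStrand (D.kind v)) (s ⟨v, h⟩))
  else none

theorem resolution_coe (s : D.State) (c : D.ClassicalCrossing) :
    resolution s c = some (xor (overStrand (D.kind c)) (s c)) := by
  simp [resolution, c.2]

theorem resolution_injective : Function.Injective (resolution (D := D)) := by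
  intro s t h
  funext ⟨v, hv⟩
  simpa [resolution, hv] using congrFun h v

/-- If no factor vanishes, then every classical crossing is smoothed and every other vertex is
passed straight ahead, which is what a state prescribes. -/
theorem prod_weight_eq_zero {ρ : D.V → Resolution} (hρ : ρ ∉ Set.range (resolution (D := D))) :
    ∏ v, weight (D.kind v) (ρ v) = 0 := by
  by_contra h0
  rw [Finset.prod_eq_zero_iff] at h0
  push Not at h0
  apply hρ
  -- `xor` with the over strand is an involution, which inverts `resolution`. The default `false` is
  -- never reached, since going straight at a classical crossing has weight 0.
  refine ⟨fun c => xor (overStrand (D.kind c)) ((ρ c).getD false), ?_⟩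
  funext v
  have := h0 v (Finset.mem_univ _)
  cases hk : D.kind v <;> cases hr : ρ v <;>
    simp_all [weight, resolution, Kind.isClassical, overStrand]

/-- The `xor` in `resolution` reflects that the value 0 respects the orientation exactly at positive
crossings; it makes the weight `a` for 0 and `a⁻¹` for 1, whatever the sign. -/
theorem prod_weight_resolution (s : D.State) :
    ∏ v, weight (D.kind v) (resolution s v) =
      ((a ^ ((alpha s : ℤ) - (beta s : ℤ)) : CoeffRingˣ) : CoeffRing) := by
  have h1 : ∏ v, weight (D.kind v) (resolution s v) =
      ∏ c : D.ClassicalCrossing, weight (D.kind c) (resolution s c) := by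
    rw [← Finset.prod_subtype (Finset.univ.filter fun v => (D.kind v).isClassical = true)
      (by simp) (fun v => weight (D.kind v) (resolution s v)), Finset.prod_filter]
    refine Finset.prod_congr rfl fun v _ => ?_
    cases hk : D.kind v <;> simp [Kind.isClassical, weight, resolution, hk]
  have h2 : ∀ c : D.ClassicalCrossing, weight (D.kind c) (resolution s c) =
      ((if s c = false then a else a⁻¹ : CoeffRingˣ) : CoeffRing) := by
    intro c
    rw [resolution_coe]
    have hv := c.2
    cases hk : D.kind c with
    | classical o => cases s c <;> cases o <;> simp [weight, overStrand]
    | flat => simp [hk, Kind.isClassical] at hv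
    | virtual => simp [hk, Kind.isClassical] at hv
  rw [h1, Finset.prod_congr rfl fun c _ => h2 c, ← Units.coe_prod, Finset.prod_ite,
    Finset.prod_const, Finset.prod_const]
  congr 1
  simp only [alpha, beta, Fintype.card_subtype, Bool.not_eq_false]
  rw [zpow_sub, zpow_natCast, zpow_natCast, inv_pow]

/-- The edge of a half-edge, named by the passage which it leaves. -/
def edge (D : SurfaceDiagram) (h : D.HalfEdge) : D.Passage :=
  if h.2 then h.1 else D.next.symm h.1

/-- `Linked` lives on half-edges and `Joined` on edges. The map `edge` glues the two halves of each
edge, and every turn at a vertex becomes a generator of `Joined`, up to direction. -/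
theorem stateValue_resolution (s : D.State) :
    stateValue (D.Linked (resolution s)) (flatMarks D.kind) =
      stateValue (D.Joined s) (fun v => {p | D.kind v = Kind.flat ∧ p.1 = v}) := by
  have hst : ∀ v x, (D.kind v).isClassical = false →
      Quot.mk (D.Joined s) (D.next.symm (v, x)) = Quot.mk (D.Joined s) (v, x) :=
    fun v x h => Quot.sound (.straight v x h)
  refine stateValue_eq_of_surjective (Equiv.refl _) D.edge ?_ ?_ ?_ ?_ ?_ ?_
  · intro p
    exact ⟨(p, true), by simp [edge]⟩
  · rintro ⟨⟨v, x⟩, o⟩ _ (rfl | rfl)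
    · cases o <;> simp [edge, opp]
    · cases hk : D.kind v with
      | classical k =>
        have hc : (D.kind v).isClassical = true := by simp [hk, Kind.isClassical]
        have hr := resolution_coe s ⟨v, hc⟩
        by_cases hks : k = s ⟨v, hc⟩
        · have key : ∀ x, Quot.mk (D.Joined s) (D.next.symm (v, x)) =
              Quot.mk (D.Joined s) (v, !x) :=
            fun x => Quot.sound (.oriented ⟨v, hc⟩ x (by simp [hk, hks]))
          have := key x
          have := key (!x)
          cases o <;> simp_all [edge, turn, overStrand]
        · have hks' : k = !(s ⟨v, hc⟩) := by revert hks; cases k <;> cases s ⟨v, hc⟩ <;> simp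
          have k1 := Quot.sound (Joined.disoriented_in (s := s) ⟨v, hc⟩ (by simp [hk, hks']))
          have k2 := Quot.sound (Joined.disoriented_out (s := s) ⟨v, hc⟩ (by simp [hk, hks']))
          cases o <;> cases x <;> simp_all [edge, turn, overStrand]
      | flat =>
        have := hst v x (by simp [hk, Kind.isClassical])
        cases o <;> simp [edge, turn, resolution, hk, Kind.isClassical, this]
      | virtual =>
        have := hst v x (by simp [hk, Kind.isClassical])
        cases o <;> simp [edge, turn, resolution, hk, Kind.isClassical, this]
  -- Each half-edge is linked to the outgoing half of its edge, so the fibres of `edge` lie in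
  -- single classes.
  · have key : ∀ x, Quot.mk (D.Linked (resolution s)) x =
        Quot.mk (D.Linked (resolution s)) (D.edge x, true) := by
      rintro ⟨p, o⟩
      cases o
      · exact Quot.sound (Or.inl (by simp [edge, opp]))
      · simp [edge]
    intro x y h
    rw [key x, key y, h]
  · rintro _ _ (⟨v, x, h⟩ | ⟨c, x, h⟩ | ⟨c, h⟩ | ⟨c, h⟩)
    · refine ⟨((v, x), false), ((v, x), true), by simp [edge], by simp [edge], ?_⟩
      exact Quot.sound (Or.inr (by simp [turn, resolution, h]))
    · refine ⟨((c, x), false), ((c, !x), true), by simp [edge], by simp [edge], ?_⟩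
      exact Quot.sound (Or.inr (by simp [turn, resolution_coe, h, overStrand]))
    · refine ⟨((c, false), false), ((c, true), false), by simp [edge], by simp [edge], ?_⟩
      exact Quot.sound (Or.inr (by simp [turn, resolution_coe, h, overStrand]))
    · refine ⟨((c, false), true), ((c, true), true), by simp [edge], by simp [edge], ?_⟩
      exact Quot.sound (Or.inr (by simp [turn, resolution_coe, h, overStrand]))
  · rintro v ⟨⟨w, x⟩, o⟩ ⟨hk, rfl⟩
    refine ⟨(w, x), ⟨hk, rfl⟩, ?_⟩
    have hk : D.kind w = Kind.flat := hk
    cases o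
    · simpa [edge] using hst w x (by simp [hk, Kind.isClassical])
    · simp [edge]
  · rintro v ⟨w, x⟩ ⟨hk, rfl⟩
    exact ⟨((w, x), true), ⟨hk, rfl⟩, by simp [edge]⟩

theorem pow_gamma (s : D.State) :
    loopValue ^ gammaEven s * b ^ gammaOdd s = loopValue ^ D.circles *
      stateValue (D.Joined s) (fun v => {p | D.kind v = Kind.flat ∧ p.1 = v}) := by
  classical
  have : Finite (Quot (D.Joined s)) := Quot.finite _
  have := Fintype.ofFinite (Quot (D.Joined s))
  have hc : ∀ c, Nat.card {v // Meets (D.Joined s)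
      (fun v => {p : D.Passage | D.kind v = Kind.flat ∧ p.1 = v}) v c} = flatCount s c := by
    intro c
    refine Nat.card_congr (Equiv.subtypeEquivRight fun v => ?_)
    constructor
    · rintro ⟨⟨w, x⟩, ⟨hk, rfl⟩, h⟩
      exact ⟨hk, x, h⟩
    · rintro ⟨hk, x, h⟩
      exact ⟨(v, x), ⟨hk, rfl⟩, h⟩
  unfold stateValue
  rw [finprod_eq_prod_of_fintype, Finset.prod_congr rfl fun c _ => by rw [hc c], Finset.prod_ite,
    Finset.prod_const, Finset.prod_const, gammaEven, gammaOdd, pow_add]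
  simp only [Nat.card_eq_fintype_card, Fintype.card_subtype, Nat.not_even_iff_odd]
  ring

/-- States embed into resolutions, and the resolutions outside the image contribute nothing. -/
theorem jones_eq (D : Diagram) :
    jones D = (((-a) ^ (-3 * D.1.writhe) : CoeffRingˣ) : CoeffRing) * D.1.bracket := by
  unfold jones bracket
  congr 1
  rw [Finset.mul_sum]
  refine Fintype.sum_of_injective resolution resolution_injective _ _ ?_ ?_
  · intro ρ hρ
    rw [prod_weight_eq_zero hρ]
    simp
  · intro s
    rw [prod_weight_resolution, stateValue_resolution, mul_assoc]
    change _ * (loopValue ^ _ * _) = _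
    rw [pow_gamma]
    ring

end SurfaceDiagram
end FlatVirtual

/-! ### Erasing virtual vertices, and the detour move -/

namespace FlatVirtual.SurfaceDiagram

namespace Erasure

variable {D E : SurfaceDiagram} {S : Set D.V} (e : Erasure D S E)

/-- The passage of `D` that corresponds to a passage of `E`. -/
def emb (q : E.Passage) : D.Passage := ((e.equiv q.1 : D.V), q.2)

/-- The edge of `E` leaving `q` runs over the edge of `D` leaving `p`. -/
def Covers (q : E.Passage) (p : D.Passage) : Prop :=
  ∃ n : ℕ, (D.next ^ n) (e.emb q) = p ∧ ∀ j, 1 ≤ j → j ≤ n → ((D.next ^ j) (e.emb q)).1 ∈ S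

theorem emb_notMem (q : E.Passage) : (e.emb q).1 ∉ S := (e.equiv q.1).2

theorem emb_injective : Function.Injective e.emb := by
  rintro ⟨v, x⟩ ⟨w, y⟩ h
  simp only [emb, Prod.mk.injEq] at h
  exact Prod.ext (e.equiv.injective (Subtype.ext h.1)) h.2

theorem exists_emb {p : D.Passage} (hp : p.1 ∉ S) : ∃ q, e.emb q = p :=
  ⟨(e.equiv.symm ⟨p.1, hp⟩, p.2), by simp [emb]⟩

theorem covers_emb (q : E.Passage) : e.Covers q (e.emb q) := ⟨0, rfl, fun j h1 h2 => by omega⟩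

theorem Covers.next {q : E.Passage} {p : D.Passage} (h : e.Covers q p) (hp : (D.next p).1 ∈ S) :
    e.Covers q (D.next p) := by
  obtain ⟨n, rfl, hn⟩ := h
  refine ⟨n + 1, by rw [pow_succ']; rfl, fun j h1 h2 => ?_⟩
  rcases h2.lt_or_eq with h2 | rfl
  · exact hn j h1 (by omega)
  · rw [pow_succ']; exact hp

/-- Walking backwards from `p`, the first passage outside `S` is determined. -/
theorem Covers.unique {q q' : E.Passage} {p : D.Passage} (h : e.Covers q p) (h' : e.Covers q' p) :
    q = q' := by
  obtain ⟨n, hn, h1⟩ := h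
  obtain ⟨n', hn', h1'⟩ := h'
  wlog hle : n ≤ n' generalizing q q' n n'
  · exact (this n' hn' h1' n hn h1 (by omega)).symm
  have h2 : e.emb q = (D.next ^ (n' - n)) (e.emb q') := by
    apply (D.next ^ n).injective
    rw [← Equiv.Perm.mul_apply, ← pow_add, Nat.add_sub_cancel' hle, hn, hn']
  rcases Nat.eq_zero_or_pos (n' - n) with h0 | h0
  · rw [h0] at h2
    exact e.emb_injective h2
  · exact (e.emb_notMem q (h2 ▸ h1' _ h0 (by omega))).elim

theorem covers_symm_next (q : E.Passage) : e.Covers q (D.next.symm (e.emb (E.next q))) := by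
  obtain ⟨n, hn, h⟩ := e.next_eq q.1 q.2 (E.next q).1 (E.next q).2 rfl
  refine ⟨n, ?_, fun j h1 h2 => ?_⟩
  · rw [Equiv.eq_symm_apply, ← Equiv.Perm.mul_apply, ← pow_succ']
    exact hn
  -- `next_eq` lists the erased passages at exponents `j + 1` with `j < n`, whereas `Covers` counts
  -- from 1; hence the shift.
  · have := h (j - 1) (by omega)
    rwa [Nat.sub_add_cancel h1] at this

/-- A shortest forward walk to `p` from a passage outside `S` meets only erased vertices after its
start; by finiteness, some forward walk exists. -/
theorem exists_covers {p r : D.Passage} (hr : r.1 ∉ S) (h : D.next.SameCycle r p) :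
    ∃ q, e.Covers q p := by
  classical
  have hex : ∃ n : ℕ, ∃ r : D.Passage, r.1 ∉ S ∧ (D.next ^ n) r = p := by
    obtain ⟨n, -, hn⟩ := h.exists_pow_eq'
    exact ⟨n, r, hr, hn⟩
  obtain ⟨r, hr, hn⟩ := Nat.find_spec hex
  obtain ⟨q, rfl⟩ := e.exists_emb hr
  refine ⟨q, _, hn, fun j h1 h2 => ?_⟩
  by_contra hj
  refine Nat.find_min hex (m := Nat.find hex - j) (by omega) ⟨_, hj, ?_⟩
  rw [← Equiv.Perm.mul_apply, ← pow_add, Nat.sub_add_cancel h2, hn]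

/-- The unicursal components of `D` that are erased completely. -/
abbrev Lost (D : SurfaceDiagram) (S : Set D.V) : Type :=
  {c : Quotient (Equiv.Perm.SameCycle.setoid D.next) //
    ∀ p : D.Passage, Quotient.mk _ p = c → p.1 ∈ S}

theorem Covers.sameCycle {q : E.Passage} {p : D.Passage} (h : e.Covers q p) :
    D.next.SameCycle p (e.emb q) := by
  obtain ⟨n, rfl, -⟩ := h
  exact (Equiv.Perm.SameCycle.refl _ _).pow_left

open Classical in
/-- The component of `E` over which an edge of `D` runs, or else its erased component. -/
noncomputable def classOf (R : E.HalfEdge → E.HalfEdge → Prop) (p : D.Passage) :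
    Quot R ⊕ Lost D S :=
  if h : ∃ q, e.Covers q p then Sum.inl (Quot.mk R (h.choose, true))
  else Sum.inr ⟨Quotient.mk _ p, fun r hr => by
    by_contra hr'
    exact h (e.exists_covers hr' (Quotient.exact hr))⟩

theorem classOf_covers (R : E.HalfEdge → E.HalfEdge → Prop) {q : E.Passage} {p : D.Passage}
    (h : e.Covers q p) : e.classOf R p = Sum.inl (Quot.mk R (q, true)) := by
  have hex : ∃ q, e.Covers q p := ⟨q, h⟩
  rw [classOf, dif_pos hex, Covers.unique e hex.choose_spec h]

theorem classOf_lost (R : E.HalfEdge → E.HalfEdge → Prop) (l : Lost D S) {p : D.Passage}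
    (h : Quotient.mk _ p = l.1) : e.classOf R p = Sum.inr l := by
  have hex : ¬ ∃ q, e.Covers q p := by
    rintro ⟨q, hq⟩
    exact e.emb_notMem q (l.2 _ ((Quotient.sound (Covers.sameCycle e hq).symm).trans h))
  rw [classOf, dif_neg hex]
  exact congrArg _ (Subtype.ext h)

/-- At an erased vertex a strand stays on the same edge of `E`, or else on the same lost component.
-/
theorem classOf_symm_next (R : E.HalfEdge → E.HalfEdge → Prop) {p : D.Passage} (hp : p.1 ∈ S) :
    e.classOf R (D.next.symm p) = e.classOf R p := by
  by_cases h : ∃ q, e.Covers q (D.next.symm p)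
  · obtain ⟨q, hq⟩ := h
    have := Covers.next e hq (by simpa using hp)
    rw [Equiv.apply_symm_apply] at this
    rw [classOf_covers e R hq, classOf_covers e R this]
  · have h' : ∀ r, D.next.SameCycle r p → r.1 ∈ S := by
      intro r hr
      by_contra hr'
      refine h (e.exists_covers hr' (hr.trans ⟨-1, ?_⟩))
      simp
    rw [classOf_lost e R ⟨Quotient.mk _ p, fun r hr => h' r (Quotient.exact hr)⟩ (p := p) rfl,
      classOf_lost e R ⟨Quotient.mk _ p, fun r hr => h' r (Quotient.exact hr)⟩]
    refine Quotient.sound ⟨1, ?_⟩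
    simp

/-- Extend a resolution of `E` by going straight ahead at the erased vertices. -/
noncomputable def lift (ρ : E.V → Resolution) : D.V → Resolution :=
  Function.extend (fun v => (e.equiv v : D.V)) ρ fun _ => none

theorem coe_equiv_injective : Function.Injective (fun v => (e.equiv v : D.V)) :=
  Subtype.val_injective.comp e.equiv.injective

theorem lift_apply (ρ : E.V → Resolution) (v : E.V) : e.lift ρ (e.equiv v) = ρ v :=
  e.coe_equiv_injective.extend_apply _ _ v

theorem lift_of_mem (ρ : E.V → Resolution) {v : D.V} (hv : v ∈ S) : e.lift ρ v = none := by
  refine Function.extend_apply' _ _ _ ?_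
  rintro ⟨w, rfl⟩
  exact (e.equiv w).2 hv

theorem turn_emb (ρ : E.V → Resolution) (q : E.Passage) (o : Bool) :
    turn (e.lift ρ) (e.emb q, o) = (e.emb (turn ρ (q, o)).1, (turn ρ (q, o)).2) := by
  have h : e.lift ρ (e.equiv q.1) = ρ q.1 := e.lift_apply ρ q.1
  simp only [turn, emb, h]
  cases ρ q.1 <;> rfl

theorem mk_edge (D : SurfaceDiagram) (ρ : D.V → Resolution) (x : D.HalfEdge) :
    Quot.mk (D.Linked ρ) x = Quot.mk (D.Linked ρ) (D.edge x, true) := by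
  obtain ⟨p, o⟩ := x
  cases o
  · exact Quot.sound (Or.inl (by simp [edge, opp]))
  · simp [edge]

theorem mk_next (D : SurfaceDiagram) (ρ : D.V → Resolution) {p : D.Passage}
    (h : ρ (D.next p).1 = none) :
    Quot.mk (D.Linked ρ) (D.next p, true) = Quot.mk (D.Linked ρ) (p, true) := by
  rw [Quot.sound (r := D.Linked ρ) (a := (D.next p, true)) (b := (D.next p, false))
    (Or.inr (by simp [turn, h])), mk_edge]
  simp [edge]

theorem mk_covers (ρ : E.V → Resolution) {q : E.Passage} {p : D.Passage} (h : e.Covers q p) :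
    Quot.mk (D.Linked (e.lift ρ)) (p, true) = Quot.mk (D.Linked (e.lift ρ)) (e.emb q, true) := by
  obtain ⟨n, rfl, hn⟩ := h
  induction n with
  | zero => rfl
  | succ n ih =>
    rw [← ih fun j h1 h2 => hn j h1 (by omega), pow_succ', Equiv.Perm.mul_apply]
    refine mk_next D _ (e.lift_of_mem ρ ?_)
    have := hn (n + 1) (by omega) le_rfl
    rwa [pow_succ'] at this

theorem mk_lost (ρ : E.V → Resolution) (l : Lost D S) {p r : D.Passage}
    (hp : Quotient.mk _ p = l.1) (hr : Quotient.mk _ r = l.1) :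
    Quot.mk (D.Linked (e.lift ρ)) (p, true) = Quot.mk (D.Linked (e.lift ρ)) (r, true) := by
  have h : D.next.SameCycle p r := Quotient.exact (hp.trans hr.symm)
  obtain ⟨n, -, rfl⟩ := h.exists_pow_eq'
  clear hr h
  induction n with
  | zero => rfl
  | succ n ih =>
    rw [ih, pow_succ', Equiv.Perm.mul_apply, mk_next]
    refine e.lift_of_mem ρ (l.2 _ ?_)
    rw [← hp]
    refine Quotient.sound (Equiv.Perm.SameCycle.symm ⟨n + 1, ?_⟩)
    rw [← Equiv.Perm.mul_apply, ← pow_succ']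
    rfl

/-- An edge of `D` either runs over a unique edge of `E` or lies on a lost component. This gives
mutually inverse maps `F` and `G` between the classes of `D` and those of `E` together with the lost
components. No flat vertex is erased, so marks correspond, and a lost component counts as a circle
without flat crossings. -/
theorem stateValue_lift (hS : ∀ v ∈ S, D.kind v = Kind.virtual) (ρ : E.V → Resolution) :
    stateValue (D.Linked (e.lift ρ)) (flatMarks D.kind) =
      stateValue (E.Linked ρ) (flatMarks E.kind) * loopValue ^ Nat.card (Lost D S) := by
  have hopp : ∀ q : E.Passage, Quot.mk (E.Linked ρ) (E.next q, false) =
      Quot.mk (E.Linked ρ) (q, true) := fun q => by rw [mk_edge]; simp [edge]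
  have hcl : ∀ q o, e.classOf (E.Linked ρ) (D.edge (e.emb q, o)) =
      Sum.inl (Quot.mk (E.Linked ρ) (q, o)) := by
    rintro q (_ | _)
    · have := e.covers_symm_next (E.next.symm q)
      rw [Equiv.apply_symm_apply] at this
      have h2 := hopp (E.next.symm q)
      rw [Equiv.apply_symm_apply] at h2
      rw [h2, ← classOf_covers e _ this]
      simp [edge]
    · rw [← classOf_covers e _ (e.covers_emb q)]
      simp [edge]
  have hG : ∀ x y, D.Linked (e.lift ρ) x y →
      e.classOf (E.Linked ρ) (D.edge x) = e.classOf (E.Linked ρ) (D.edge y) := by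
    rintro ⟨p, o⟩ _ (rfl | rfl)
    · cases o <;> simp [edge, opp]
    · by_cases hp : p.1 ∈ S
      · have := classOf_symm_next e (E.Linked ρ) hp
        cases o <;> simp [edge, turn, e.lift_of_mem ρ hp, this]
      · obtain ⟨q, rfl⟩ := e.exists_emb hp
        rw [turn_emb, hcl, hcl]
        exact congrArg _ (Quot.sound (Or.inr rfl))
  have hF : ∀ x y, E.Linked ρ x y → Quot.mk (D.Linked (e.lift ρ)) (e.emb x.1, x.2) =
      Quot.mk (D.Linked (e.lift ρ)) (e.emb y.1, y.2) := by
    have key : ∀ q : E.Passage, Quot.mk (D.Linked (e.lift ρ)) (e.emb (E.next q), false) =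
        Quot.mk (D.Linked (e.lift ρ)) (e.emb q, true) := by
      intro q
      rw [← mk_covers e ρ (e.covers_symm_next q), mk_edge]
      simp [edge]
    rintro ⟨q, o⟩ _ (rfl | rfl)
    · cases o
      · have := key (E.next.symm q)
        rw [Equiv.apply_symm_apply] at this
        simpa [opp] using this
      · simpa [opp] using (key q).symm
    · exact Quot.sound (Or.inr (turn_emb e ρ q o).symm)
  let F : Quot (E.Linked ρ) ⊕ Lost D S → Quot (D.Linked (e.lift ρ)) :=
    Sum.elim (Quot.lift (fun x => Quot.mk _ (e.emb x.1, x.2)) hF)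
      (fun l => Quot.mk _ (l.1.out, true))
  let G : Quot (D.Linked (e.lift ρ)) → Quot (E.Linked ρ) ⊕ Lost D S :=
    Quot.lift (fun x => e.classOf _ (D.edge x)) hG
  have hGF : Function.LeftInverse G F := by
    rintro (⟨q, o⟩ | l)
    · exact hcl q o
    · exact classOf_lost e _ l (by simp [edge])
  have hFG : Function.LeftInverse F G := by
    rintro ⟨x⟩
    rw [mk_edge]
    generalize D.edge x = p
    change F (e.classOf _ (D.edge (p, true))) = _
    have he : D.edge (p, true) = p := by simp [edge]
    rw [he]
    by_cases h : ∃ q, e.Covers q p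
    · obtain ⟨q, hq⟩ := h
      rw [classOf_covers e _ hq, mk_covers e ρ hq]
      rfl
    · let l : Lost D S := ⟨Quotient.mk _ p, fun r hr => by
        by_contra hr'
        exact h (e.exists_covers hr' (Quotient.exact hr))⟩
      rw [classOf_lost e _ l rfl]
      exact mk_lost e ρ l (Quotient.out_eq _) rfl
  have hflat : ∀ v, D.kind v = Kind.flat → v ∉ S := by
    intro v h hv
    rw [hS v hv] at h
    cases h
  refine stateValue_eq_of_bijective (fun v => (e.equiv v : D.V)) e.coe_equiv_injective F
    ⟨hGF.injective, hFG.surjective⟩ ?_ ?_ ?_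
  · intro v c
    constructor
    · rintro ⟨⟨⟨w, x⟩, o⟩, ⟨hk, rfl⟩, h⟩
      refine ⟨((v, x), o), ⟨(e.kind_eq v).trans hk, rfl⟩, ?_⟩
      have h' := congrArg G h
      rw [hGF] at h'
      exact Sum.inl_injective ((hcl (v, x) o).symm.trans h')
    · rintro ⟨⟨⟨w, x⟩, o⟩, ⟨hk, rfl⟩, rfl⟩
      exact ⟨((e.equiv w, x), o), ⟨(e.kind_eq w).symm.trans hk, rfl⟩, rfl⟩
  · intro v hv
    rw [Set.eq_empty_iff_forall_notMem]
    rintro x ⟨hk, -⟩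
    exact hv ⟨e.equiv.symm ⟨v, hflat v hk⟩, by simp⟩
  · rintro v l ⟨⟨p, o⟩, ⟨hk, rfl⟩, h⟩
    obtain ⟨q, rfl⟩ := e.exists_emb (p := p) (hflat _ hk)
    have h' := congrArg G h
    rw [hGF] at h'
    have := (hcl q o).symm.trans h'
    simp at this

theorem prod_weight_lift (hS : ∀ v ∈ S, D.kind v = Kind.virtual) (ρ : E.V → Resolution) :
    ∏ v, weight (D.kind v) (e.lift ρ v) = ∏ v, weight (E.kind v) (ρ v) := by
  symm
  refine Fintype.prod_of_injective _ e.coe_equiv_injective _ _ ?_ ?_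
  · intro v hv
    have hv : v ∈ S := by
      by_contra h
      exact hv ⟨e.equiv.symm ⟨v, h⟩, by simp⟩
    simp [e.lift_of_mem ρ hv, hS v hv, weight]
  · intro v
    rw [lift_apply, e.kind_eq]

end Erasure

variable {D E D' : SurfaceDiagram} {S : Set D.V}

/-- The factor `loopValue` of each lost component is the one that the corresponding new circle
contributes to `circles`. A resolution that is not a lift smooths some virtual vertex and has weight
0. -/
theorem Erasure.bracket_eq (e : Erasure D S E) (hS : ∀ v ∈ S, D.kind v = Kind.virtual) :
    D.bracket = E.bracket := by
  unfold bracket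
  rw [e.circles_eq, pow_add, mul_assoc, Finset.mul_sum Finset.univ _ (loopValue ^ Nat.card _)]
  congr 1
  symm
  refine Fintype.sum_of_injective e.lift ?_ _ _ ?_ ?_
  · intro ρ ρ' h
    funext v
    rw [← e.lift_apply ρ, ← e.lift_apply ρ', h]
  · intro ρ hρ
    have : ∃ v ∈ S, ρ v ≠ none := by
      by_contra! h
      refine hρ ⟨fun v => ρ (e.equiv v), ?_⟩
      funext v
      by_cases hv : v ∈ S
      · rw [e.lift_of_mem _ hv, h v hv]
      · obtain ⟨w, hw⟩ := e.equiv.surjective ⟨v, hv⟩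
        have hw : (e.equiv w : D.V) = v := congrArg Subtype.val hw
        subst hw
        rw [e.lift_apply]
    obtain ⟨v, hv, hr⟩ := this
    rw [Finset.prod_eq_zero (Finset.mem_univ v), zero_mul]
    rw [hS v hv]
    cases h : ρ v
    · exact (hr h).elim
    · rfl
  · intro ρ
    rw [e.prod_weight_lift hS, e.stateValue_lift hS]
    ring

theorem Erasure.writhe_eq (e : Erasure D S E) (hS : ∀ v ∈ S, D.kind v = Kind.virtual) :
    D.writhe = E.writhe := by
  rw [writhe_eq_sum, writhe_eq_sum]
  symm
  refine Fintype.sum_of_injective _ e.coe_equiv_injective _ _ ?_ ?_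
  · intro v hv
    have hv : v ∈ S := by
      by_contra h
      exact hv ⟨e.equiv.symm ⟨v, h⟩, by simp⟩
    simp [hS v hv, Kind.sign]
  · intro v
    rw [e.kind_eq]

/-- An isomorphism erases nothing. -/
noncomputable def Iso.erasure (i : Iso D D') : Erasure D ∅ D' where
  equiv := i.equiv.symm.trans (Equiv.subtypeUnivEquiv (by simp)).symm
  kind_eq v := by
    have := i.kind_eq (i.equiv.symm v)
    simpa using this
  next_eq v x w y h := by
    refine ⟨0, ?_, by simp⟩
    have := i.next_eq (i.equiv.symm v) x (D.next (i.equiv.symm v, x)).1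
      (D.next (i.equiv.symm v, x)).2 rfl
    rw [Equiv.apply_symm_apply, h, Prod.mk.injEq] at this
    refine Prod.ext ?_ ?_
    · exact (Equiv.eq_symm_apply _).2 this.1.symm
    · exact this.2.symm
  circles_eq := by
    have : IsEmpty {c : Quotient (Equiv.Perm.SameCycle.setoid D.next) //
        ∀ p : D.Passage, Quotient.mk _ p = c → p.1 ∈ (∅ : Set D.V)} := by
      refine ⟨?_⟩
      rintro ⟨⟨p⟩, h⟩
      exact h p rfl
    rw [i.circles_eq, Nat.card_of_isEmpty, add_zero]

open Classical in
/-- Vertex types, those of `S` replaced by virtual ones. -/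
noncomputable def virtualKind (D : SurfaceDiagram) (S : Set D.V) (v : D.V) : Kind :=
  if v ∈ S then Kind.virtual else D.kind v

/-- Replace the vertices of `S` by virtual ones. -/
noncomputable def virtualize (D : SurfaceDiagram) (S : Set D.V) : SurfaceDiagram where
  V := D.V
  kind := D.virtualKind S
  next := D.next
  circles := D.circles

/-- Vertices may be made virtual before they are erased. -/
def Erasure.virtualize (e : Erasure D S E) : Erasure (D.virtualize S) S E where
  equiv := e.equiv
  kind_eq v := (e.kind_eq v).trans (if_neg (e.equiv v).2).symm
  next_eq := e.next_eq
  circles_eq := e.circles_eq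

/-- The flat-virtual Jones polynomial of a diagram on any surface. -/
noncomputable def polynomial (D : SurfaceDiagram) : CoeffRing :=
  (((-a) ^ (-3 * D.writhe) : CoeffRingˣ) : CoeffRing) * D.bracket

theorem Erasure.polynomial_eq (e : Erasure D S E) (hS : ∀ v ∈ S, D.kind v = Kind.virtual) :
    D.polynomial = E.polynomial := by
  rw [polynomial, polynomial, e.bracket_eq hS, e.writhe_eq hS]

/-- With this, a move that deletes vertices becomes a comparison of two sets of vertex types on one
and the same graph. -/
theorem Erasure.polynomial_virtualize (e : Erasure D S E) :
    (D.virtualize S).polynomial = E.polynomial :=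
  e.virtualize.polynomial_eq fun _ hv => if_pos hv

theorem Iso.polynomial_eq (i : Iso D D') : D.polynomial = D'.polynomial :=
  i.erasure.polynomial_eq (by simp)

theorem HasVirtualStrand.polynomial_eq {p : E.Place} (h : D.HasVirtualStrand E p) :
    D.polynomial = E.polynomial := by
  obtain ⟨-, -, ⟨i⟩⟩ | ⟨_, _, hv, e, -⟩ := h
  · exact i.polynomial_eq
  · exact e.polynomial_eq hv

/-- Erasing the virtual strand turns both diagrams into the same `E`. -/
theorem Detour.polynomial_eq (h : D.Detour D') : D.polynomial = D'.polynomial := by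
  obtain ⟨E, p, h1, h2⟩ := h
  rw [h1.polynomial_eq, h2.polynomial_eq]

end FlatVirtual.SurfaceDiagram

/-! ### Polygonal faces and the contraction of their sides -/

namespace FlatVirtual.SurfaceDiagram

section HalfEdges

variable (D : SurfaceDiagram)

@[simp] theorem opp_opp (x : D.HalfEdge) : D.opp (D.opp x) = x := by
  obtain ⟨p, _ | _⟩ := x <;> simp [opp]

theorem opp_snd (x : D.HalfEdge) : (D.opp x).2 = !x.2 := by
  obtain ⟨p, _ | _⟩ := x <;> simp [opp]

theorem rot_rot (x : D.HalfEdge) : D.rot (D.rot x) = (x.1, !x.2) := by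
  obtain ⟨⟨v, _ | _⟩, o⟩ := x <;> simp [rot]

theorem rot_strand (x : D.HalfEdge) : (D.rot x).1 = (x.1.1, !x.1.2) := by
  obtain ⟨⟨v, _ | _⟩, o⟩ := x <;> simp [rot]

theorem rot_symm_strand (x : D.HalfEdge) : (D.rot.symm x).1 = (x.1.1, !x.1.2) := by
  obtain ⟨⟨v, _ | _⟩, o⟩ := x <;> simp [rot]

theorem rot_rot_rot (x : D.HalfEdge) : D.rot (D.rot (D.rot x)) = D.rot.symm x := by
  obtain ⟨⟨v, _ | _⟩, o⟩ := x <;> simp [rot]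

theorem eq_of_vertex_eq {x h : D.HalfEdge} (hx : x.1.1 = h.1.1) :
    x = h ∨ x = D.rot h ∨ x = D.rot (D.rot h) ∨ x = D.rot.symm h := by
  obtain ⟨⟨v, x⟩, o⟩ := x
  obtain ⟨⟨w, y⟩, u⟩ := h
  cases hx
  cases x <;> cases o <;> cases y <;> cases u <;> simp [rot]

theorem rot_ne (x : D.HalfEdge) : D.rot x ≠ x := fun h => by
  have := congrArg (fun y => y.1.2) h
  simp [rot_strand] at this

theorem rot_rot_ne (x : D.HalfEdge) : D.rot (D.rot x) ≠ x := fun h => by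
  have := congrArg Prod.snd h
  simp [rot_rot] at this

variable {D}

theorem turn_vertex {V : Type} (ρ : V → Resolution) (x : (V × Bool) × Bool) :
    (turn ρ x).1.1 = x.1.1 := by
  unfold turn
  cases ρ x.1.1 <;> rfl

theorem turn_congr {V : Type} {ρ ρ' : V → Resolution} (x : (V × Bool) × Bool)
    (h : ρ x.1.1 = ρ' x.1.1) : turn ρ x = turn ρ' x := by
  simp only [turn, h]

end HalfEdges

/-- The relation obtained from `base` by inserting a polygon with corners `ι`, where the side
following the corner `i` is contracted to the point `i`.  At the corner `i` the other two ends are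
`A i` (opposite to the side `prv i`) and `B i` (opposite to the side `i`); the corner is
passed straight ahead, or its two sides are joined (`some false`), or they are not
joined (`some true`). -/
inductive Tangle {K ι : Type} (base : K → K → Prop) (A B : ι → K) (prv : ι → ι)
    (τ : ι → Resolution) : K ⊕ ι → K ⊕ ι → Prop
  | base (k l : K) (h : base k l) : Tangle base A B prv τ (.inl k) (.inl l)
  | straight (i : ι) (h : τ i = none) : Tangle base A B prv τ (.inr i) (.inl (B i))
  | straight_prv (i : ι) (h : τ i = none) : Tangle base A B prv τ (.inr (prv i)) (.inl (A i))
  | inner (i : ι) (h : τ i = some false) : Tangle base A B prv τ (.inr i) (.inr (prv i))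
  | outer (i : ι) (h : τ i = some false) : Tangle base A B prv τ (.inl (A i)) (.inl (B i))
  | turn (i : ι) (h : τ i = some true) : Tangle base A B prv τ (.inr i) (.inl (A i))
  | turn_prv (i : ι) (h : τ i = some true) : Tangle base A B prv τ (.inr (prv i)) (.inl (B i))

/-- A face of `D` whose corners are different vertices. -/
structure Polygon (D : SurfaceDiagram) (ι : Type) where
  corner : ι → D.HalfEdge
  prv : ι → ι
  surjective : Function.Surjective prv
  face_eq : ∀ i, D.face (corner (prv i)) = corner i
  injective : Function.Injective fun i => D.vertex (corner i)

namespace Polygon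

variable {D : SurfaceDiagram} {ι : Type} (P : Polygon D ι)

/-- The half-edges that do not belong to a side. -/
abbrev Outer : Type := {x : D.HalfEdge // ¬ ∃ i, x = P.corner i ∨ D.opp x = P.corner i}

/-- The vertices of the polygon. -/
abbrev vert (i : ι) : D.V := D.vertex (P.corner i)

theorem opp_corner (i : ι) : D.opp (P.corner (P.prv i)) = D.rot.symm (P.corner i) := by
  rw [Equiv.eq_symm_apply]
  exact P.face_eq i

theorem opp_rot_symm (i : ι) : D.opp (D.rot.symm (P.corner i)) = P.corner (P.prv i) := by
  rw [← opp_corner, opp_opp]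

theorem corner_eq_of_vertex {i j : ι} (h : (P.corner i).1.1 = (P.corner j).1.1) : i = j :=
  P.injective h

/-- A vertex carries only one corner of the polygon, so only `corner i` and its clockwise neighbour
belong to sides there. -/
theorem outer_of {x : D.HalfEdge} (i : ι) (hv : x.1.1 = (P.corner i).1.1) (h1 : x ≠ P.corner i)
    (h2 : x ≠ D.rot.symm (P.corner i)) : ¬ ∃ i, x = P.corner i ∨ D.opp x = P.corner i := by
  rintro ⟨j, h | h⟩
  · rw [h] at hv
    cases P.corner_eq_of_vertex hv
    exact h1 h
  · obtain ⟨k, rfl⟩ := P.surjective j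
    have h : x = D.rot.symm (P.corner k) := by rw [← opp_corner, ← h, opp_opp]
    rw [h, rot_symm_strand] at hv
    cases P.corner_eq_of_vertex hv
    exact h2 h

/-- The end opposite to the preceding side. -/
def A (i : ι) : P.Outer := ⟨D.rot (P.corner i), P.outer_of i (by rw [rot_strand]) (D.rot_ne _)
  fun h => D.rot_rot_ne (D.rot.symm (P.corner i)) (by rw [Equiv.apply_symm_apply, h])⟩

/-- The end opposite to the following side. -/
def B (i : ι) : P.Outer := ⟨D.rot (D.rot (P.corner i)),
  P.outer_of i (by rw [rot_rot]) (D.rot_rot_ne _)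
  fun h => by
    have := congrArg (fun y => y.1.2) h
    simp [rot_symm_strand, rot_rot] at this⟩

open Classical in
/-- Contract the sides to points. -/
noncomputable def collapse (x : D.HalfEdge) : P.Outer ⊕ ι :=
  if h : ∃ i, x = P.corner i ∨ D.opp x = P.corner i then .inr h.choose else .inl ⟨x, h⟩

theorem collapse_outer (k : P.Outer) : P.collapse k.1 = .inl k := dif_neg k.2

/-- The polygon cannot run along an edge from both ends: some corner would then equal its own
clockwise neighbour, which lies on the other strand. Hence every edge is a side in at most one way,
and `collapse` is well determined. -/
theorem corner_or_unique {x : D.HalfEdge} {i j : ι} (hi : x = P.corner i ∨ D.opp x = P.corner i)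
    (hj : x = P.corner j ∨ D.opp x = P.corner j) : i = j := by
  have key : ∀ i j, x = P.corner i → D.opp x = P.corner j → False := by
    intro i j h1 h2
    subst h1
    obtain ⟨k, rfl⟩ := P.surjective j
    rw [← opp_rot_symm, EmbeddingLike.apply_eq_iff_eq] at h2
    have := congrArg (fun y => y.1.1) h2
    rw [rot_symm_strand] at this
    cases P.corner_eq_of_vertex this
    have := congrArg (fun y => y.1.2) h2
    simp [rot_symm_strand] at this
  rcases hi with hi | hi <;> rcases hj with hj | hj
  · exact P.injective (congrArg D.vertex (hi.symm.trans hj))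
  · exact (key _ _ hi hj).elim
  · exact (key _ _ hj hi).elim
  · exact P.injective (congrArg D.vertex (hi.symm.trans hj))

theorem collapse_inner {x : D.HalfEdge} {i : ι} (h : x = P.corner i ∨ D.opp x = P.corner i) :
    P.collapse x = .inr i := by
  have hex : ∃ i, x = P.corner i ∨ D.opp x = P.corner i := ⟨i, h⟩
  rw [collapse, dif_pos hex, P.corner_or_unique hex.choose_spec h]

theorem collapse_corner (i : ι) : P.collapse (P.corner i) = .inr i := P.collapse_inner (.inl rfl)

theorem collapse_rot_symm (i : ι) : P.collapse (D.rot.symm (P.corner i)) = .inr (P.prv i) :=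
  P.collapse_inner (.inr (P.opp_rot_symm i))

theorem collapse_rot (i : ι) : P.collapse (D.rot (P.corner i)) = .inl (P.A i) :=
  P.collapse_outer (P.A i)

theorem collapse_rot_rot (i : ι) : P.collapse (D.rot (D.rot (P.corner i))) = .inl (P.B i) :=
  P.collapse_outer (P.B i)

theorem outer_of_vertex {x : D.HalfEdge} (h : ∀ i, x.1.1 ≠ P.vert i) :
    ¬ ∃ i, x = P.corner i ∨ D.opp x = P.corner i := by
  rintro ⟨i, hi | hi⟩
  · exact h i (by rw [hi]; rfl)
  · obtain ⟨j, rfl⟩ := P.surjective i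
    have : x = D.rot.symm (P.corner j) := by rw [← opp_corner, ← hi, opp_opp]
    exact h j (by rw [this, rot_symm_strand]; rfl)

/-- The relation outside the polygon. -/
def base (ρ : D.V → Resolution) (k l : P.Outer) : Prop :=
  l.1 = D.opp k.1 ∨ (∀ i, k.1.1.1 ≠ P.vert i) ∧ l.1 = turn ρ k.1

/-- The flat vertices after contraction of the sides. -/
def marks (κ : D.V → Kind) (v : D.V) : Set (P.Outer ⊕ ι) :=
  {z | κ v = Kind.flat ∧ ((∃ k : P.Outer, z = .inl k ∧ k.1.1.1 = v ∧ ∀ i, v ≠ P.vert i) ∨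
    ∃ i, v = P.vert i ∧ (z = .inr i ∨ z = .inr (P.prv i)))}

/-- The resolutions of the corners, seen from the polygon. -/
def types (ρ : D.V → Resolution) (i : ι) : Resolution :=
  (ρ (P.vert i)).map (xor (P.corner i).1.2)

/-- Counterclockwise from `corner i`, the half-edges belong to the side `i`, the end `A i`, the end
`B i` and the side `prv i`. The `xor` in `types` removes the dependence on orientations, so three
pictures suffice. -/
theorem turn_corner (ρ : D.V → Resolution) (i : ι) :
    (P.types ρ i = none ∧ turn ρ (P.corner i) = D.rot (D.rot (P.corner i)) ∧
      turn ρ (D.rot.symm (P.corner i)) = D.rot (P.corner i) ∧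
      turn ρ (D.rot (P.corner i)) = D.rot.symm (P.corner i) ∧
      turn ρ (D.rot (D.rot (P.corner i))) = P.corner i) ∨
    (P.types ρ i = some false ∧ turn ρ (P.corner i) = D.rot.symm (P.corner i) ∧
      turn ρ (D.rot.symm (P.corner i)) = P.corner i ∧
      turn ρ (D.rot (P.corner i)) = D.rot (D.rot (P.corner i)) ∧
      turn ρ (D.rot (D.rot (P.corner i))) = D.rot (P.corner i)) ∨
    (P.types ρ i = some true ∧ turn ρ (P.corner i) = D.rot (P.corner i) ∧
      turn ρ (D.rot.symm (P.corner i)) = D.rot (D.rot (P.corner i)) ∧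
      turn ρ (D.rot (P.corner i)) = P.corner i ∧
      turn ρ (D.rot (D.rot (P.corner i))) = D.rot.symm (P.corner i)) := by
  unfold types
  rw [vert, vertex]
  obtain ⟨⟨v, x⟩, o⟩ := P.corner i
  cases h : ρ v with
  | none => cases x <;> cases o <;> simp [turn, rot, h]
  | some d => cases d <;> cases x <;> cases o <;> simp [turn, rot, h]

/-- The two halves of a side are always linked, so contracting it loses nothing. A flat corner is
passed straight ahead, so each of its two strands contains one of the adjacent sides, and marking
those sides is enough. -/
theorem stateValue_eq [Finite ι] (κ : D.V → Kind) (ρ : D.V → Resolution)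
    (hflat : ∀ i, κ (P.vert i) = Kind.flat → ρ (P.vert i) = none) :
    stateValue (D.Linked ρ) (flatMarks κ) =
      stateValue (Tangle (P.base ρ) P.A P.B P.prv (P.types ρ)) (P.marks κ) := by
  have hopp : ∀ x, D.Linked ρ x (D.opp x) := fun x => Or.inl rfl
  have hturn : ∀ x, Quot.mk (D.Linked ρ) x = Quot.mk (D.Linked ρ) (turn ρ x) :=
    fun x => Quot.sound (Or.inr rfl)
  have hT := fun u v => Quot.sound (r := Tangle (P.base ρ) P.A P.B P.prv (P.types ρ))
    (a := u) (b := v)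
  have hsurj : Function.Surjective P.collapse := by
    rintro (k | i)
    · exact ⟨k.1, P.collapse_outer k⟩
    · exact ⟨_, P.collapse_corner i⟩
  have h1 : ∀ x y, D.Linked ρ x y →
      Quot.mk (Tangle (P.base ρ) P.A P.B P.prv (P.types ρ)) (P.collapse x) =
        Quot.mk (Tangle (P.base ρ) P.A P.B P.prv (P.types ρ)) (P.collapse y) := by
    rintro x _ (rfl | rfl)
    · by_cases h : ∃ i, x = P.corner i ∨ D.opp x = P.corner i
      · obtain ⟨i, hi⟩ := h
        rw [P.collapse_inner hi, P.collapse_inner (i := i)]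
        rwa [opp_opp, or_comm]
      · have h' : ¬ ∃ i, D.opp x = P.corner i ∨ D.opp (D.opp x) = P.corner i := by
          simpa only [opp_opp, or_comm] using h
        rw [P.collapse_outer ⟨x, h⟩, P.collapse_outer ⟨D.opp x, h'⟩]
        exact hT _ _ (.base _ _ (Or.inl rfl))
    · by_cases h : ∃ i, x.1.1 = P.vert i
      · obtain ⟨i, hi⟩ := h
        have e1 := P.collapse_corner i
        have e2 := P.collapse_rot_symm i
        have e3 := P.collapse_rot i
        have e4 := P.collapse_rot_rot i
        obtain ⟨t0, t1, t2, t3, t4⟩ | ⟨t0, t1, t2, t3, t4⟩ | ⟨t0, t1, t2, t3, t4⟩ :=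
          P.turn_corner ρ i
        · have k1 := hT _ _ (.straight i t0)
          have k2 := hT _ _ (.straight_prv i t0)
          obtain rfl | rfl | rfl | rfl := D.eq_of_vertex_eq hi
          · rw [t1, e1, e4, k1]
          · rw [t3, e2, e3, k2]
          · rw [t4, e1, e4, k1]
          · rw [t2, e2, e3, k2]
        · have k1 := hT _ _ (.inner i t0)
          have k2 := hT _ _ (.outer i t0)
          obtain rfl | rfl | rfl | rfl := D.eq_of_vertex_eq hi
          · rw [t1, e1, e2, k1]
          · rw [t3, e3, e4, k2]
          · rw [t4, e3, e4, k2]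
          · rw [t2, e1, e2, k1]
        · have k1 := hT _ _ (.turn i t0)
          have k2 := hT _ _ (.turn_prv i t0)
          obtain rfl | rfl | rfl | rfl := D.eq_of_vertex_eq hi
          · rw [t1, e1, e3, k1]
          · rw [t3, e1, e3, k1]
          · rw [t4, e2, e4, k2]
          · rw [t2, e2, e4, k2]
      · push Not at h
        have h' : ∀ i, (turn ρ x).1.1 ≠ P.vert i := by rwa [turn_vertex]
        rw [P.collapse_outer ⟨x, P.outer_of_vertex h⟩, P.collapse_outer ⟨_, P.outer_of_vertex h'⟩]
        exact hT _ _ (.base _ _ (Or.inr ⟨h, rfl⟩))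
  refine stateValue_eq_of_surjective (Equiv.refl _) P.collapse hsurj h1 ?_ ?_ ?_ ?_
  · intro x y hxy
    by_cases hx : ∃ i, x = P.corner i ∨ D.opp x = P.corner i
    · obtain ⟨i, hi⟩ := hx
      rw [P.collapse_inner hi] at hxy
      by_cases hy : ∃ i, y = P.corner i ∨ D.opp y = P.corner i
      · obtain ⟨j, hj⟩ := hy
        rw [P.collapse_inner hj] at hxy
        cases hxy
        have key : ∀ x, (x = P.corner i ∨ D.opp x = P.corner i) →
            Quot.mk (D.Linked ρ) x = Quot.mk (D.Linked ρ) (P.corner i) := by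
          rintro x (rfl | h)
          · rfl
          · rw [← h]; exact Quot.sound (hopp x)
        rw [key x hi, key y hj]
      · rw [P.collapse_outer ⟨y, hy⟩] at hxy
        cases hxy
    · rw [P.collapse_outer ⟨x, hx⟩] at hxy
      by_cases hy : ∃ i, y = P.corner i ∨ D.opp y = P.corner i
      · obtain ⟨j, hj⟩ := hy
        rw [P.collapse_inner hj] at hxy
        cases hxy
      · rw [P.collapse_outer ⟨y, hy⟩] at hxy
        cases hxy
        rfl
  · rintro _ _ (⟨k, l, h | ⟨-, h⟩⟩ | ⟨i, h⟩ | ⟨i, h⟩ | ⟨i, h⟩ | ⟨i, h⟩ | ⟨i, h⟩ | ⟨i, h⟩)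
    · exact ⟨k.1, l.1, P.collapse_outer k, P.collapse_outer l, by rw [h]; exact Quot.sound (hopp _)⟩
    · exact ⟨k.1, l.1, P.collapse_outer k, P.collapse_outer l, by rw [h]; exact hturn _⟩
    · refine ⟨_, _, P.collapse_corner i, P.collapse_rot_rot i, ?_⟩
      rw [hturn]
      rcases P.turn_corner ρ i with h' | h' | h' <;>
        first | (rw [h'.2.1]; done) | exact absurd (h.symm.trans h'.1) (by simp)
    · refine ⟨_, _, P.collapse_rot_symm i, P.collapse_rot i, ?_⟩
      rw [hturn]
      rcases P.turn_corner ρ i with h' | h' | h' <;>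
        first | (rw [h'.2.2.1]; done) | exact absurd (h.symm.trans h'.1) (by simp)
    · refine ⟨_, _, P.collapse_corner i, P.collapse_rot_symm i, ?_⟩
      rw [hturn]
      rcases P.turn_corner ρ i with h' | h' | h' <;>
        first | (rw [h'.2.1]; done) | exact absurd (h.symm.trans h'.1) (by simp)
    · refine ⟨_, _, P.collapse_rot i, P.collapse_rot_rot i, ?_⟩
      rw [hturn]
      rcases P.turn_corner ρ i with h' | h' | h' <;>
        first | (rw [h'.2.2.2.1]; done) | exact absurd (h.symm.trans h'.1) (by simp)
    · refine ⟨_, _, P.collapse_corner i, P.collapse_rot i, ?_⟩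
      rw [hturn]
      rcases P.turn_corner ρ i with h' | h' | h' <;>
        first | (rw [h'.2.1]; done) | exact absurd (h.symm.trans h'.1) (by simp)
    · refine ⟨_, _, P.collapse_rot_symm i, P.collapse_rot_rot i, ?_⟩
      rw [hturn]
      rcases P.turn_corner ρ i with h' | h' | h' <;>
        first | (rw [h'.2.2.1]; done) | exact absurd (h.symm.trans h'.1) (by simp)
  · rintro _ x ⟨hk, rfl⟩
    by_cases h : ∃ i, x.1.1 = P.vert i
    · obtain ⟨i, hi⟩ := h
      have t0 : P.types ρ i = none := by
        rw [types, hflat i (hi ▸ hk), Option.map_none]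
      obtain rfl | rfl | rfl | rfl := D.eq_of_vertex_eq hi
      · exact ⟨.inr i, ⟨hk, .inr ⟨i, hi, .inl rfl⟩⟩, by rw [collapse_corner]⟩
      · refine ⟨.inr (P.prv i), ⟨hk, .inr ⟨i, hi, .inr rfl⟩⟩, ?_⟩
        rw [collapse_rot, hT _ _ (.straight_prv i t0)]
      · refine ⟨.inr i, ⟨hk, .inr ⟨i, hi, .inl rfl⟩⟩, ?_⟩
        rw [collapse_rot_rot, hT _ _ (.straight i t0)]
      · exact ⟨.inr (P.prv i), ⟨hk, .inr ⟨i, hi, .inr rfl⟩⟩, by rw [collapse_rot_symm]⟩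
    · push Not at h
      refine ⟨.inl ⟨x, P.outer_of_vertex h⟩, ⟨hk, .inl ⟨_, rfl, rfl, h⟩⟩, ?_⟩
      rw [P.collapse_outer ⟨x, P.outer_of_vertex h⟩]
  · rintro _ y ⟨hk, ⟨k, rfl, rfl, -⟩ | ⟨i, rfl, rfl | rfl⟩⟩
    · exact ⟨k.1, ⟨hk, rfl⟩, by rw [collapse_outer]⟩
    · exact ⟨P.corner i, ⟨hk, rfl⟩, by rw [collapse_corner]⟩
    · exact ⟨D.rot.symm (P.corner i), ⟨hk, by rw [rot_symm_strand]; rfl⟩, by rw [collapse_rot_symm]⟩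

end Polygon

end FlatVirtual.SurfaceDiagram

/-! ### Evaluation of contracted polygons as matchings of outer ends -/

namespace FlatVirtual.SurfaceDiagram

/-- The relation obtained from `base` by joining `A i` to `B (σ i)`. -/
def Matched {K ι : Type} (base : K → K → Prop) (A B : ι → K) (σ : ι → ι) (k l : K) : Prop :=
  base k l ∨ ∃ i, k = A i ∧ l = B (σ i)

section Evaluation

variable {K V ι : Type} {base : K → K → Prop} {A B : ι → K} {prv : ι → ι}
  {τ : ι → Resolution} {σ : ι → ι}

/-- The identifications made at a corner of type `τ`. -/
def CornerJoins {X : Type} (side side' outA outB : X) : Resolution → Prop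
  | none => side = outB ∧ side' = outA
  | some false => side = side' ∧ outA = outB
  | some true => side = outA ∧ side' = outB

theorem Tangle.cornerJoins (base : K → K → Prop) (A B : ι → K) (prv : ι → ι)
    (τ : ι → Resolution) (i : ι) :
    CornerJoins (Quot.mk (Tangle base A B prv τ) (.inr i))
      (Quot.mk (Tangle base A B prv τ) (.inr (prv i)))
      (Quot.mk (Tangle base A B prv τ) (.inl (A i)))
      (Quot.mk (Tangle base A B prv τ) (.inl (B i))) (τ i) := by
  rcases h : τ i with _ | _ | _
  · exact ⟨Quot.sound (.straight i h), Quot.sound (.straight_prv i h)⟩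
  · exact ⟨Quot.sound (.inner i h), Quot.sound (.outer i h)⟩
  · exact ⟨Quot.sound (.turn i h), Quot.sound (.turn_prv i h)⟩

/-- A function on the points of a tangle descends to classes if it does at every corner. -/
theorem Tangle.lift_eq {X : Type} (f : K ⊕ ι → X)
    (hb : ∀ k l, base k l → f (.inl k) = f (.inl l))
    (hc : ∀ i, CornerJoins (f (.inr i)) (f (.inr (prv i))) (f (.inl (A i))) (f (.inl (B i))) (τ i))
    (x y : K ⊕ ι) (h : Tangle base A B prv τ x y) : f x = f y := by
  rcases h with ⟨k, l, h⟩ | ⟨i, h⟩ | ⟨i, h⟩ | ⟨i, h⟩ | ⟨i, h⟩ | ⟨i, h⟩ | ⟨i, h⟩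
  · exact hb k l h
  all_goals
    have := hc i
    rw [h] at this
    first | exact this.1 | exact this.2

/-- Here `z i` is an outer end on the same arc as the side `i`. Replacing sides by these ends
eliminates them, and only the matching `σ` of outer ends remains. -/
theorem stateValue_tangle [Finite K] [Finite ι] (m : V → Set K) (z : ι → K)
    (hz : ∀ i, CornerJoins (Quot.mk (Matched base A B σ) (z i))
      (Quot.mk (Matched base A B σ) (z (prv i))) (Quot.mk (Matched base A B σ) (A i))
      (Quot.mk (Matched base A B σ) (B i)) (τ i))
    (hz' : ∀ i, Quot.mk (Tangle base A B prv τ) (.inr i) =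
      Quot.mk (Tangle base A B prv τ) (.inl (z i)))
    (hσ : ∀ i, Quot.mk (Tangle base A B prv τ) (.inl (A i)) =
      Quot.mk (Tangle base A B prv τ) (.inl (B (σ i)))) :
    stateValue (Tangle base A B prv τ) (fun v => Sum.inl '' m v) =
      stateValue (Matched base A B σ) m := by
  have key : ∀ x : K ⊕ ι, Quot.mk (Tangle base A B prv τ) x =
      Quot.mk (Tangle base A B prv τ) (.inl (Sum.elim id z x)) := by
    rintro (k | i)
    · rfl
    · exact hz' i
  refine stateValue_eq_of_surjective (Equiv.refl _) (Sum.elim id z) (fun k => ⟨.inl k, rfl⟩)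
    (Tangle.lift_eq (fun x => Quot.mk (Matched base A B σ) (Sum.elim id z x))
      (fun k l h => Quot.sound (Or.inl h)) hz) ?_ ?_ ?_ ?_
  · intro x y h
    rw [key x, key y, h]
  · rintro u w (h | ⟨i, rfl, rfl⟩)
    · exact ⟨.inl u, .inl w, rfl, rfl, Quot.sound (.base u w h)⟩
    · exact ⟨.inl _, .inl _, rfl, rfl, hσ i⟩
  · rintro v _ ⟨k, hk, rfl⟩
    exact ⟨k, hk, rfl⟩
  · rintro v k hk
    exact ⟨.inl k, ⟨k, hk, rfl⟩, rfl⟩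

/-- The sides close up into one curve disjoint from the outer ends and free of marks, which accounts
for the factor `loopValue`. -/
theorem stateValue_tangle_loop [Finite K] [Finite ι] [Nonempty ι] (m : V → Set K)
    (hτ : ∀ i, τ i = some false)
    (hconn : ∀ i j, Quot.mk (Tangle base A B prv τ) (.inr i) =
      Quot.mk (Tangle base A B prv τ) (.inr j)) :
    stateValue (Tangle base A B prv τ) (fun v => Sum.inl '' m v) =
      stateValue (Matched base A B id) m * loopValue := by
  have hG := Tangle.lift_eq (prv := prv) (τ := τ) (A := A) (B := B) (base := base)
    (Sum.elim (fun k => Sum.inl (Quot.mk (Matched base A B id) k)) (fun _ => Sum.inr ()))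
    (fun k l h => congrArg Sum.inl (Quot.sound (Or.inl h)))
    (fun i => by
      rw [hτ i]
      exact ⟨rfl, congrArg Sum.inl (Quot.sound (Or.inr ⟨i, rfl, rfl⟩))⟩)
  have hF : ∀ k l, Matched base A B id k l → Quot.mk (Tangle base A B prv τ) (.inl k) =
      Quot.mk (Tangle base A B prv τ) (.inl l) := by
    rintro k l (h | ⟨i, rfl, rfl⟩)
    · exact Quot.sound (.base k l h)
    · exact Quot.sound (.outer i (hτ i))
  let F : Quot (Matched base A B id) ⊕ Unit → Quot (Tangle base A B prv τ) :=
    Sum.elim (Quot.lift (fun k => Quot.mk _ (.inl k)) hF)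
      (fun _ => Quot.mk _ (.inr (Classical.arbitrary ι)))
  let G : Quot (Tangle base A B prv τ) → Quot (Matched base A B id) ⊕ Unit := Quot.lift _ hG
  have hGF : Function.LeftInverse G F := by
    rintro (k | l)
    · induction k using Quot.ind
      rfl
    · rfl
  have hFG : Function.LeftInverse F G := by
    rintro ⟨k | i⟩
    · rfl
    · exact hconn _ _
  rw [stateValue_eq_of_bijective (m' := m) id Function.injective_id F
    ⟨hGF.injective, hFG.surjective⟩ ?_ ?_ ?_]
  · simp
  · rintro v c
    constructor
    · rintro ⟨_, ⟨k, hk, rfl⟩, h⟩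
      have h' := congrArg G h
      rw [hGF] at h'
      exact ⟨k, hk, Sum.inl_injective h'⟩
    · rintro ⟨k, hk, rfl⟩
      exact ⟨.inl k, ⟨k, hk, rfl⟩, rfl⟩
  · intro v hv
    exact (hv ⟨v, rfl⟩).elim
  · rintro v l ⟨_, ⟨k, hk, rfl⟩, h⟩
    have h' := congrArg G h
    rw [hGF] at h'
    cases h'

theorem Matched.mk_eq (base : K → K → Prop) (A B : ι → K) (σ : ι → ι) (i : ι) :
    Quot.mk (Matched base A B σ) (A i) = Quot.mk (Matched base A B σ) (B (σ i)) :=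
  Quot.sound (Or.inr ⟨i, rfl, rfl⟩)

theorem stateValue_matched_congr [Finite K] (m : V → Set K) {A' B' : ι → K} {σ' : ι → ι}
    (h : ∀ i, Quot.mk (Matched base A B σ) (A' i) = Quot.mk (Matched base A B σ) (B' (σ' i)))
    (h' : ∀ i, Quot.mk (Matched base A' B' σ') (A i) =
      Quot.mk (Matched base A' B' σ') (B (σ i))) :
    stateValue (Matched base A B σ) m = stateValue (Matched base A' B' σ') m := by
  refine stateValue_eq_of_surjective (Equiv.refl _) id Function.surjective_id ?_ ?_ ?_ ?_ ?_
  · rintro x y (hb | ⟨i, rfl, rfl⟩)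
    · exact Quot.sound (Or.inl hb)
    · exact h' i
  · rintro x y rfl
    rfl
  · rintro x y (hb | ⟨i, rfl, rfl⟩)
    · exact ⟨x, y, rfl, rfl, Quot.sound (Or.inl hb)⟩
    · exact ⟨_, _, rfl, rfl, h i⟩
  · exact fun v x hx => ⟨x, hx, rfl⟩
  · exact fun v x hx => ⟨x, hx, rfl⟩

end Evaluation

section Monogon

variable {K V : Type} [Finite K] (base : K → K → Prop) (A B : Fin 1 → K) (m : V → Set K)

theorem stateValue_monogon_false :
    stateValue (Tangle base A B id fun _ => some false) (fun v => Sum.inl '' m v) =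
      stateValue (Matched base A B id) m * loopValue :=
  stateValue_tangle_loop m (fun _ => rfl) fun i j => by rw [Subsingleton.elim i j]

/-- The only side precedes and follows the corner, so both remaining types join it to both outer
ends. -/
theorem stateValue_monogon {τ : Fin 1 → Resolution} (hτ : τ 0 ≠ some false) :
    stateValue (Tangle base A B id τ) (fun v => Sum.inl '' m v) =
      stateValue (Matched base A B id) m := by
  have h0 := Matched.mk_eq base A B id 0
  have t0 := Tangle.cornerJoins base A B id τ 0
  refine stateValue_tangle m A ?_ ?_ ?_ <;> intro i <;> fin_cases i <;>
    rcases h : τ 0 with _ | _ | _ <;> simp_all [CornerJoins] <;> grind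

end Monogon

section Bigon

variable {K V : Type} [Finite K] (base : K → K → Prop) (A B : Fin 2 → K) (m : V → Set K)

theorem stateValue_bigon_loop :
    stateValue (Tangle base A B ![1, 0] ![some false, some false]) (fun v => Sum.inl '' m v) =
      stateValue (Matched base A B id) m * loopValue := by
  have t0 := Tangle.cornerJoins base A B ![1, 0] ![some false, some false] 0
  refine stateValue_tangle_loop m (by decide) ?_
  simp [CornerJoins] at t0
  intro i j
  fin_cases i <;> fin_cases j <;> simp <;> grind

/-- The last two cases share a matching: the double smoothing that survives in the second move
connects the ends just as two virtual corners do. -/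
theorem stateValue_bigon {τ : Fin 2 → Resolution} (z : Fin 2 → K) (σ : Fin 2 → Fin 2)
    (h : τ = ![some false, some true] ∧ z = ![A 1, A 1] ∧ σ = id ∨
      τ = ![some true, some false] ∧ z = ![A 0, A 0] ∧ σ = id ∨
      τ = ![some true, some true] ∧ z = A ∧ σ = ![1, 0] ∨
      τ = ![none, none] ∧ z = B ∧ σ = ![1, 0]) :
    stateValue (Tangle base A B ![1, 0] τ) (fun v => Sum.inl '' m v) =
      stateValue (Matched base A B σ) m := by
  have m0 := Matched.mk_eq base A B σ 0
  have m1 := Matched.mk_eq base A B σ 1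
  have t0 := Tangle.cornerJoins base A B ![1, 0] τ 0
  have t1 := Tangle.cornerJoins base A B ![1, 0] τ 1
  refine stateValue_tangle m z ?_ ?_ ?_ <;> intro i <;> fin_cases i <;>
    rcases h with ⟨rfl, rfl, rfl⟩ | ⟨rfl, rfl, rfl⟩ | ⟨rfl, rfl, rfl⟩ | ⟨rfl, rfl, rfl⟩ <;>
    simp [CornerJoins] at t0 t1 m0 m1 ⊢ <;> grind

end Bigon

section Triangle

variable {K V : Type} [Finite K] (base : K → K → Prop) (A B : Fin 3 → K) (m : V → Set K)

theorem stateValue_triangle_loop :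
    stateValue (Tangle base A B ![2, 0, 1] ![some false, some false, some false])
      (fun v => Sum.inl '' m v) = stateValue (Matched base A B id) m * loopValue := by
  have t0 := Tangle.cornerJoins base A B ![2, 0, 1] ![some false, some false, some false] 0
  have t1 := Tangle.cornerJoins base A B ![2, 0, 1] ![some false, some false, some false] 1
  refine stateValue_tangle_loop m (by decide) ?_
  simp [CornerJoins] at t0 t1
  intro i j
  fin_cases i <;> fin_cases j <;> simp <;> grind

/-- Each line records, for one picture, an outer end on the arc of each side and the resulting
matching. The first seven are the smoothings without a closed loop; the last serves the mixed move.
-/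
theorem stateValue_triangle {τ : Fin 3 → Resolution} (z : Fin 3 → K) (σ : Fin 3 → Fin 3)
    (h : τ = ![some false, some true, some false] ∧ z = ![A 1, A 1, A 1] ∧ σ = id ∨
      τ = ![some true, some false, some false] ∧ z = ![A 0, A 0, A 0] ∧ σ = id ∨
      τ = ![some true, some true, some false] ∧ z = ![A 0, A 1, A 1] ∧ σ = ![1, 0, 2] ∨
      τ = ![some false, some false, some true] ∧ z = ![A 2, A 2, A 2] ∧ σ = id ∨
      τ = ![some false, some true, some true] ∧ z = ![A 2, A 1, A 2] ∧ σ = ![0, 2, 1] ∨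
      τ = ![some true, some false, some true] ∧ z = ![A 0, A 0, A 2] ∧ σ = ![2, 1, 0] ∨
      τ = ![some true, some true, some true] ∧ z = A ∧ σ = ![1, 2, 0] ∨
      τ = ![none, none, some false] ∧ z = ![B 0, B 1, B 1] ∧ σ = ![1, 0, 2]) :
    stateValue (Tangle base A B ![2, 0, 1] τ) (fun v => Sum.inl '' m v) =
      stateValue (Matched base A B σ) m := by
  have m0 := Matched.mk_eq base A B σ 0
  have m1 := Matched.mk_eq base A B σ 1
  have m2 := Matched.mk_eq base A B σ 2
  have t0 := Tangle.cornerJoins base A B ![2, 0, 1] τ 0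
  have t1 := Tangle.cornerJoins base A B ![2, 0, 1] τ 1
  have t2 := Tangle.cornerJoins base A B ![2, 0, 1] τ 2
  refine stateValue_tangle m z ?_ ?_ ?_ <;> intro i <;> fin_cases i <;>
    rcases h with ⟨rfl, rfl, rfl⟩ | ⟨rfl, rfl, rfl⟩ | ⟨rfl, rfl, rfl⟩ | ⟨rfl, rfl, rfl⟩ |
      ⟨rfl, rfl, rfl⟩ | ⟨rfl, rfl, rfl⟩ | ⟨rfl, rfl, rfl⟩ | ⟨rfl, rfl, rfl⟩ <;>
    simp [CornerJoins] at t0 t1 t2 m0 m1 m2 ⊢ <;> grind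

/-- The matchings of the ends of the slid triangle, in terms of those of the triangle. -/
theorem stateValue_matched_slide (σ σ' : Fin 3 → Fin 3)
    (h : σ = id ∧ σ' = ![1, 2, 0] ∨ σ = ![1, 2, 0] ∧ σ' = id ∨ σ = σ' ∧
      (σ = ![1, 0, 2] ∨ σ = ![0, 2, 1] ∨ σ = ![2, 1, 0])) :
    stateValue (Matched base (fun i => B (![2, 0, 1] i)) (fun i => A (![1, 2, 0] i)) σ') m =
      stateValue (Matched base A B σ) m := by
  have m0 := Matched.mk_eq base A B σ 0
  have m1 := Matched.mk_eq base A B σ 1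
  have m2 := Matched.mk_eq base A B σ 2
  have m0' := Matched.mk_eq base (fun i => B (![2, 0, 1] i)) (fun i => A (![1, 2, 0] i)) σ' 0
  have m1' := Matched.mk_eq base (fun i => B (![2, 0, 1] i)) (fun i => A (![1, 2, 0] i)) σ' 1
  have m2' := Matched.mk_eq base (fun i => B (![2, 0, 1] i)) (fun i => A (![1, 2, 0] i)) σ' 2
  refine stateValue_matched_congr m ?_ ?_ <;> intro i <;> fin_cases i <;>
    rcases h with ⟨rfl, rfl⟩ | ⟨rfl, rfl⟩ | ⟨rfl, rfl | rfl | rfl⟩ <;>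
    simp at m0 m1 m2 m0' m1' m2' ⊢ <;> grind

end Triangle

end FlatVirtual.SurfaceDiagram

/-! ### Local weights and localization of the state sum -/

namespace FlatVirtual.SurfaceDiagram

section Weights

theorem a_mul_inv : (a : CoeffRing) * ((a⁻¹ : CoeffRingˣ) : CoeffRing) = 1 := a.mul_inv

theorem loopValue_eq : loopValue = -(a : CoeffRing) ^ 2 - ((a⁻¹ : CoeffRingˣ) : CoeffRing) ^ 2 := by
  simp only [loopValue, zpow_neg, zpow_ofNat, ← inv_pow, Units.val_pow_eq_pow_val]

/-- Turning an overcrossing `corner i` counterclockwise sweeps the region towards `A i`, not the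
face. So the 0-smoothing is the one that joins the two sides of the face, and it carries `a`; at an
undercrossing corner the roles are exchanged. -/
theorem sum_weight_over (x : Bool) (f : Resolution → CoeffRing) :
    ∑ r : Resolution, weight (Kind.classical x) (r.map (xor x)) * f r =
      a * f (some false) + ((a⁻¹ : CoeffRingˣ) : CoeffRing) * f (some true) := by
  cases x <;> simp [Fintype.sum_option, weight, add_comm]

theorem sum_weight_under (x : Bool) (f : Resolution → CoeffRing) :
    ∑ r : Resolution, weight (Kind.classical !x) (r.map (xor x)) * f r =
      ((a⁻¹ : CoeffRingˣ) : CoeffRing) * f (some false) + a * f (some true) := by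
  cases x <;> simp [Fintype.sum_option, weight, add_comm]

theorem sum_weight_flat (x : Bool) (f : Resolution → CoeffRing) :
    ∑ r : Resolution, weight Kind.flat (r.map (xor x)) * f r = f none := by
  simp [Fintype.sum_option, weight]

theorem sum_cons {n : ℕ} (w : Fin (n + 1) → Resolution → CoeffRing)
    (f : (Fin (n + 1) → Resolution) → CoeffRing) :
    ∑ τ, (∏ i, w i (τ i)) * f τ = ∑ x, w 0 x * ∑ τ : Fin n → Resolution,
      (∏ i : Fin n, w i.succ (τ i)) * f (Matrix.vecCons x τ) := by
  rw [← (Fin.consEquiv fun _ => Resolution).sum_comp, Fintype.sum_prod_type]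
  refine Finset.sum_congr rfl fun x _ => ?_
  rw [Finset.mul_sum]
  refine Finset.sum_congr rfl fun τ _ => ?_
  rw [Fin.prod_univ_succ, ← mul_assoc]
  rfl

theorem sum_fin_one (w : Fin 1 → Resolution → CoeffRing) (f : (Fin 1 → Resolution) → CoeffRing) :
    ∑ τ, (∏ i, w i (τ i)) * f τ = ∑ x, w 0 x * f ![x] := by
  rw [sum_cons]
  refine Finset.sum_congr rfl fun x _ => ?_
  rw [Fintype.sum_subsingleton _ ![]]
  simp

theorem sum_fin_two (w : Fin 2 → Resolution → CoeffRing) (f : (Fin 2 → Resolution) → CoeffRing) :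
    ∑ τ, (∏ i, w i (τ i)) * f τ = ∑ x, w 0 x * ∑ y, w 1 y * f ![x, y] := by
  rw [sum_cons]
  exact Finset.sum_congr rfl fun x _ => congrArg _ (sum_fin_one (fun i => w i.succ) _)

theorem sum_fin_three (w : Fin 3 → Resolution → CoeffRing) (f : (Fin 3 → Resolution) → CoeffRing) :
    ∑ τ, (∏ i, w i (τ i)) * f τ = ∑ x, w 0 x * ∑ y, w 1 y * ∑ z, w 2 z * f ![x, y, z] := by
  rw [sum_cons]
  exact Finset.sum_congr rfl fun x _ => congrArg _ (sum_fin_two (fun i => w i.succ) _)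

end Weights

section Virtualize

variable {D : SurfaceDiagram} (S : Set D.V)

theorem opp_virtualize (x : D.HalfEdge) : (D.virtualize S).opp x = D.opp x := by
  obtain ⟨p, _ | _⟩ := x <;> rfl

theorem linked_virtualize (ρ : D.V → Resolution) :
    (D.virtualize S).Linked ρ = D.Linked ρ := by
  funext x y
  exact congrArg (fun z => y = z ∨ y = turn ρ x) (opp_virtualize S x)

end Virtualize

namespace Polygon

section

variable {D : SurfaceDiagram} {ι : Type} (P : Polygon D ι)

/-- Prescribe the types of the corners. -/
noncomputable def insert (ρ : D.V → Resolution) (τ : ι → Resolution) : D.V → Resolution :=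
  Function.extend P.vert (fun i => (τ i).map (xor (P.corner i).1.2)) ρ

theorem insert_vert (ρ : D.V → Resolution) (τ : ι → Resolution) (i : ι) :
    P.insert ρ τ (P.vert i) = (τ i).map (xor (P.corner i).1.2) :=
  P.injective.extend_apply _ _ i

theorem insert_of_ne (ρ : D.V → Resolution) (τ : ι → Resolution) {v : D.V}
    (h : ∀ i, v ≠ P.vert i) : P.insert ρ τ v = ρ v := by
  refine Function.extend_apply' _ _ _ ?_
  rintro ⟨i, hi⟩
  exact h i hi.symm

theorem types_insert (ρ : D.V → Resolution) (τ : ι → Resolution) :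
    P.types (P.insert ρ τ) = τ := by
  funext i
  rw [types, insert_vert, Option.map_map]
  convert Option.map_id'
  simp

theorem base_insert (ρ : D.V → Resolution) (τ : ι → Resolution) :
    P.base (P.insert ρ τ) = P.base ρ := by
  funext k l
  refine propext (or_congr_right (and_congr_right fun h => ?_))
  rw [turn_congr _ (P.insert_of_ne ρ τ h)]

variable (κ : D.V → Kind)

/-- The flat vertices outside the polygon. -/
def outerMarks (v : D.V) : Set P.Outer :=
  {k | κ v = Kind.flat ∧ k.1.1.1 = v ∧ ∀ i, v ≠ P.vert i}

theorem marks_of_ne {v : D.V} (hv : ∀ i, κ (P.vert i) = Kind.flat → v ≠ P.vert i) :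
    P.marks κ v = Sum.inl '' P.outerMarks κ v := by
  ext z
  constructor
  · rintro ⟨hk, ⟨k, rfl, h⟩ | ⟨i, rfl, h⟩⟩
    · exact ⟨k, ⟨hk, h⟩, rfl⟩
    · exact (hv i hk rfl).elim
  · rintro ⟨k, ⟨hk, h⟩, rfl⟩
    exact ⟨hk, .inl ⟨k, rfl, h⟩⟩

theorem marks_eq (h : ∀ i, κ (P.vert i) ≠ Kind.flat) :
    P.marks κ = fun v => Sum.inl '' P.outerMarks κ v :=
  funext fun _ => P.marks_of_ne κ fun i hi => (h i hi).elim

theorem marks_vert {i : ι} (h : κ (P.vert i) = Kind.flat) :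
    P.marks κ (P.vert i) = {.inr i, .inr (P.prv i)} := by
  ext z
  constructor
  · rintro ⟨hk, ⟨k, rfl, -, h⟩ | ⟨j, hj, h⟩⟩
    · exact (h i rfl).elim
    · cases P.injective hj
      exact h
  · intro hz
    exact ⟨h, .inr ⟨i, rfl, hz⟩⟩

/-- Two flat corners with the same sides may be unmarked. -/
theorem stateValue_unmark_corners (r : P.Outer ⊕ ι → P.Outer ⊕ ι → Prop) {i j : ι} (hij : i ≠ j)
    (hi : κ (P.vert i) = Kind.flat) (hj : κ (P.vert j) = Kind.flat)
    (hk : ∀ l, l ≠ i → l ≠ j → κ (P.vert l) ≠ Kind.flat)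
    (h : Quot.mk r (.inr i) = Quot.mk r (.inr (P.prv j)))
    (h' : Quot.mk r (.inr (P.prv i)) = Quot.mk r (.inr j)) :
    stateValue r (P.marks κ) = stateValue r fun v => Sum.inl '' P.outerMarks κ v := by
  have key : ∀ i, Sum.inl '' P.outerMarks κ (P.vert i) = (∅ : Set (P.Outer ⊕ ι)) := by
    intro i
    rw [Set.image_eq_empty, Set.eq_empty_iff_forall_notMem]
    rintro k ⟨-, -, h⟩
    exact h i rfl
  refine stateValue_unmark (v := P.vert i) (w := P.vert j) (fun h => hij (P.injective h)) ?_
    (key i) (key j) ?_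
  · intro c
    simp only [Meets, P.marks_vert κ hi, P.marks_vert κ hj, Set.mem_insert_iff,
      Set.mem_singleton_iff, exists_eq_or_imp, exists_eq_left, h, h']
    exact or_comm
  · intro v hv hv'
    refine P.marks_of_ne κ fun l hl hvl => ?_
    subst hvl
    exact hk l (fun h => hv (by rw [h])) (fun h => hv' (by rw [h])) hl

end

section

variable {D : SurfaceDiagram} {n : ℕ} (P : Polygon D (Fin n))

theorem stateValue_insert (ρ : D.V → Resolution) (τ : Fin n → Resolution)
    {κ : D.V → Kind} (hτ : ∀ i, κ (P.vert i) = Kind.flat → τ i = none) :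
    stateValue (D.Linked (P.insert ρ τ)) (flatMarks κ) =
      stateValue (Tangle (P.base ρ) P.A P.B P.prv τ) (P.marks κ) := by
  rw [P.stateValue_eq, base_insert, types_insert]
  intro i hi
  rw [insert_vert, hτ i hi, Option.map_none]

open Classical in
/-- Go straight ahead at the corners. -/
noncomputable def extend (u : {v : D.V // ∀ i, v ≠ P.vert i} → Resolution) (v : D.V) :
    Resolution :=
  if h : ∀ i, v ≠ P.vert i then u ⟨v, h⟩ else none

/-- A resolution is the same as its restriction to the outside together with the types of the
corners; `extend` merely supplies values that `insert` overwrites. -/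
theorem sum_insert (F : (D.V → Resolution) → CoeffRing) :
    ∑ ρ, F ρ = ∑ u : {v : D.V // ∀ i, v ≠ P.vert i} → Resolution, ∑ τ,
      F (P.insert (P.extend u) τ) := by
  let e : ({v : D.V // ∀ i, v ≠ P.vert i} → Resolution) × (Fin n → Resolution) ≃
      (D.V → Resolution) :=
    { toFun := fun x => P.insert (P.extend x.1) x.2
      invFun := fun ρ => (fun v => ρ v, P.types ρ)
      left_inv := by
        rintro ⟨u, τ⟩
        refine Prod.ext ?_ (P.types_insert _ _)
        funext v
        change P.insert _ _ v.1 = _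
        rw [P.insert_of_ne _ _ v.2, extend, dif_pos v.2]
      right_inv := by
        intro ρ
        funext v
        by_cases h : ∀ i, v ≠ P.vert i
        · change P.insert (P.extend fun v => ρ v) (P.types ρ) v = ρ v
          rw [P.insert_of_ne _ _ h, extend, dif_pos h]
        · push Not at h
          obtain ⟨i, rfl⟩ := h
          change P.insert (P.extend fun v => ρ v) (P.types ρ) _ = _
          rw [insert_vert, types, Option.map_map]
          convert Option.map_id'
          simp }
  rw [← e.sum_comp, Fintype.sum_prod_type]
  rfl

theorem prod_insert (k : D.V → Kind) (ρ : D.V → Resolution) (τ : Fin n → Resolution) :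
    ∏ v, weight (k v) (P.insert ρ τ v) =
      (∏ i, weight (k (P.vert i)) ((τ i).map (xor (P.corner i).1.2))) *
        ∏ v with ∀ i, v ≠ P.vert i, weight (k v) (ρ v) := by
  rw [← Finset.prod_filter_mul_prod_filter_not Finset.univ (fun v => ∀ i, v ≠ P.vert i), mul_comm]
  congr 1
  · symm
    refine Finset.prod_bij (fun i _ => P.vert i) ?_ ?_ ?_ ?_
    · simp
    · intro i _ j _ h
      exact P.injective h
    · intro v hv
      simp only [Finset.mem_filter, Finset.mem_univ, true_and, not_forall, not_not] at hv
      obtain ⟨i, hi⟩ := hv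
      exact ⟨i, Finset.mem_univ _, hi.symm⟩
    · intro i _
      rw [insert_vert]
  · refine Finset.prod_congr rfl fun v hv => ?_
    rw [P.insert_of_ne _ _ (Finset.mem_filter.1 hv).2]

/-- State sums may be compared one resolution of the outside at a time. -/
theorem sum_congr {k k' : D.V → Kind} (hk : ∀ v, (∀ i, v ≠ P.vert i) → k' v = k v)
    {W W' : (D.V → Resolution) → CoeffRing} (c : CoeffRing)
    (h : ∀ ρ, ∑ τ : Fin n → Resolution,
        (∏ i, weight (k (P.vert i)) ((τ i).map (xor (P.corner i).1.2))) * W (P.insert ρ τ) =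
      c * ∑ τ : Fin n → Resolution,
        (∏ i, weight (k' (P.vert i)) ((τ i).map (xor (P.corner i).1.2))) * W' (P.insert ρ τ)) :
    ∑ ρ, (∏ v, weight (k v) (ρ v)) * W ρ = c * ∑ ρ, (∏ v, weight (k' v) (ρ v)) * W' ρ := by
  rw [P.sum_insert, P.sum_insert, Finset.mul_sum]
  refine Finset.sum_congr rfl fun u _ => ?_
  have hk' : ∏ v with ∀ i, v ≠ P.vert i, weight (k' v) (P.extend u v) =
      ∏ v with ∀ i, v ≠ P.vert i, weight (k v) (P.extend u v) :=
    Finset.prod_congr rfl fun v hv => by rw [hk v (Finset.mem_filter.1 hv).2]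
  simp only [P.prod_insert, hk', mul_right_comm _ _ (W _), mul_right_comm _ _ (W' _)]
  rw [← Finset.sum_mul, ← Finset.sum_mul, h, mul_assoc]

end

end Polygon

end FlatVirtual.SurfaceDiagram

/-! ### Moves that remove a monogon or a bigon -/

namespace FlatVirtual.SurfaceDiagram

variable {D D' : SurfaceDiagram}

namespace Polygon

/-- The monogon of a half-edge. -/
def monogon (h : D.HalfEdge) (hh : D.IsMonogon h) : Polygon D (Fin 1) where
  corner _ := h
  prv := id
  surjective := Function.surjective_id
  face_eq _ := hh
  injective := Function.injective_of_subsingleton _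

/-- The bigon of a half-edge. -/
def bigon (h : D.HalfEdge) (hh : D.IsBigon h) : Polygon D (Fin 2) where
  corner := ![h, D.face h]
  prv := ![1, 0]
  surjective := by decide
  face_eq i := by
    fin_cases i
    · exact hh.1
    · rfl
  injective i j hij := by
    fin_cases i <;> fin_cases j
    · rfl
    · exact (hh.2 hij).elim
    · exact (hh.2 hij.symm).elim
    · rfl

/-- The triangle of a half-edge. -/
def triangle (h : D.HalfEdge) (hh : D.IsTriangle h) : Polygon D (Fin 3) where
  corner := ![h, D.face h, D.face (D.face h)]
  prv := ![2, 0, 1]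
  surjective := by decide
  face_eq i := by
    fin_cases i
    · exact hh.1
    · rfl
    · rfl
  injective i j hij := by
    obtain ⟨-, h1, h2, h3⟩ := hh
    fin_cases i <;> fin_cases j
    · rfl
    · exact (h1 hij).elim
    · exact (h3 hij.symm).elim
    · exact (h1 hij.symm).elim
    · rfl
    · exact (h2 hij).elim
    · exact (h3 hij).elim
    · exact (h2 hij.symm).elim
    · rfl

variable {n : ℕ} (P : Polygon D (Fin n)) {S : Set D.V}

/-- This reduces a removal move to one local identity for each outside resolution. The factor `c` is
what the writhe has to compensate: `(-a) ^ 3` or `(-a) ^ (-3)` for a curl, 1 for a bigon. -/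
theorem bracket_eq_virtualize (hS : ∀ v, v ∈ S ↔ ∃ i, v = P.vert i) (c : CoeffRing)
    (h : ∀ ρ, ∑ τ : Fin n → Resolution,
        (∏ i, weight (D.kind (P.vert i)) ((τ i).map (xor (P.corner i).1.2))) *
          stateValue (D.Linked (P.insert ρ τ)) (flatMarks D.kind) =
      c * stateValue (Tangle (P.base ρ) P.A P.B P.prv fun _ => none)
        (fun v => Sum.inl '' P.outerMarks D.kind v)) :
    D.bracket = c * (D.virtualize S).bracket := by
  have hk : ∀ i, (D.virtualKind S) (P.vert i) = Kind.virtual :=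
    fun i => if_pos ((hS _).2 ⟨i, rfl⟩)
  have hk' : ∀ v, (∀ i, v ≠ P.vert i) → (D.virtualKind S) v = D.kind v := by
    intro v hv
    refine if_neg fun hv' => ?_
    obtain ⟨i, hi⟩ := (hS v).1 hv'
    exact hv i hi
  have hm : P.outerMarks (D.virtualKind S) = P.outerMarks D.kind := by
    funext v
    ext k
    refine and_congr_left fun hv => ?_
    rw [hk' v hv.2]
  have key := P.sum_congr (k := D.kind) (k' := (D.virtualKind S)) hk'
    (W := fun ρ => stateValue (D.Linked ρ) (flatMarks D.kind))
    (W' := fun ρ => stateValue (D.Linked ρ) (flatMarks (D.virtualKind S))) c ?_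
  · have h' : (D.virtualize S).bracket = loopValue ^ D.circles *
        ∑ ρ, (∏ v, weight ((D.virtualKind S) v) (ρ v)) *
          stateValue (D.Linked ρ) (flatMarks (D.virtualKind S)) := by
      change loopValue ^ D.circles * ∑ ρ : D.V → Resolution,
        (∏ v : D.V, weight ((D.virtualKind S) v) (ρ v)) *
          stateValue ((D.virtualize S).Linked ρ) (flatMarks (D.virtualKind S)) = _
      congr 1
      refine Finset.sum_congr rfl fun ρ _ => ?_
      have := linked_virtualize S ρ
      exact congrArg (fun r : D.HalfEdge → D.HalfEdge → Prop =>
        (∏ v : D.V, weight ((D.virtualKind S) v) (ρ v)) *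
          stateValue r (flatMarks (D.virtualKind S))) this
    rw [bracket, h', key]
    ring
  · intro ρ
    refine (h ρ).trans (congrArg _ ?_)
    -- Both smoothings of a virtual corner have weight 0, so only the straight choice survives.
    rw [Fintype.sum_eq_single (fun _ => none)]
    · rw [P.stateValue_insert _ _ (by simp), P.marks_eq _ (by simp [hk]), hm]
      simp [hk, weight]
    · intro τ hτ
      obtain ⟨i, hi⟩ := Function.ne_iff.1 hτ
      rw [Finset.prod_eq_zero (Finset.mem_univ i), zero_mul]
      rw [hk]
      cases h : τ i
      · exact (hi h).elim
      · rfl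

theorem writhe_eq_virtualize (hS : ∀ v, v ∈ S ↔ ∃ i, v = P.vert i) :
    D.writhe = (D.virtualize S).writhe + ∑ i, (D.kind (P.vert i)).sign := by
  classical
  rw [writhe_eq_sum, writhe_eq_sum, ← Finset.sum_filter_not_add_sum_filter Finset.univ (· ∈ S)]
  congr 1
  · rw [Finset.sum_filter]
    refine Finset.sum_congr rfl fun v _ => ?_
    change _ = (ite (v ∈ S) Kind.virtual (D.kind v)).sign
    split_ifs <;> simp_all [Kind.sign]
  · symm
    refine Finset.sum_bij (fun i _ => P.vert i) ?_ ?_ ?_ ?_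
    · intro i _
      simpa using (hS _).2 ⟨i, rfl⟩
    · intro i _ j _ h
      exact P.injective h
    · intro v hv
      obtain ⟨i, hi⟩ := (hS v).1 (Finset.mem_filter.1 hv).2
      exact ⟨i, Finset.mem_univ _, hi.symm⟩
    · intro i _
      rfl

end Polygon

/-- The direction of the next side of a face. -/
theorem face_snd (h : D.HalfEdge) : (D.face h).2 = xor h.2 (D.face h).1.2 := by
  change (D.rot (D.opp h)).2 = xor h.2 (D.rot (D.opp h)).1.2
  have := D.opp_snd h
  generalize D.opp h = y at *
  obtain ⟨⟨v, _ | _⟩, o⟩ := y <;> simp_all [rot]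

theorem opp_strand (h : D.HalfEdge) : (D.opp h).1 = ((D.face h).1.1, !(D.face h).1.2) := by
  change _ = ((D.rot (D.opp h)).1.1, !(D.rot (D.opp h)).1.2)
  rw [rot_strand]
  simp

theorem isClassical_iff (h : D.HalfEdge) :
    (D.kind (D.vertex h)).isClassical = true ↔ D.IsOver h ∨ D.IsUnder h := by
  unfold IsOver IsUnder
  cases D.kind (D.vertex h) with
  | classical o => cases o <;> cases h.1.2 <;> simp [Kind.isClassical]
  | flat => simp [Kind.isClassical]
  | virtual => simp [Kind.isClassical]

theorem isOver_opp {h : D.HalfEdge} (hh : D.IsOver (D.opp h)) : D.IsUnder (D.face h) := by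
  have := D.opp_strand h
  simpa [IsOver, IsUnder, vertex, this] using hh

theorem units_pow_mul {e w w' k : ℤ} (h : w = w' + e) (he : k = 3 * e) :
    (((-a) ^ (-3 * w) : CoeffRingˣ) : CoeffRing) * (((-a) ^ k : CoeffRingˣ) : CoeffRing) =
      (((-a) ^ (-3 * w') : CoeffRingˣ) : CoeffRing) := by
  rw [← Units.val_mul, ← zpow_add, h, he]
  congr 2
  ring

/-- One smoothing splits off a loop and the other does not. The coefficients are `aδ + a⁻¹ = -a³`
for a positive curl and `a⁻¹δ + a = -a⁻³` for a negative one, where `δ = loopValue`. -/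
theorem ClassicalR1.polynomial_eq (hR : D.ClassicalR1 D') : D.polynomial = D'.polynomial := by
  obtain ⟨h, hh, hc, ⟨e⟩⟩ := hR
  rw [← e.polynomial_virtualize, polynomial, polynomial]
  let P := Polygon.monogon h hh
  have hS : ∀ v, v ∈ ({D.vertex h} : Set D.V) ↔ ∃ i, v = P.vert i := by
    intro v
    simp [P, Polygon.monogon, Polygon.vert]
  -- At a fixed point of `face`, `face_snd` reads `h.2 = xor h.2 h.1.2`. The corner thus lies on the
  -- strand `false`, so being over or under decides the sign of the crossing.
  have hx : h.1.2 = false := by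
    have := D.face_snd h
    rw [hh] at this
    revert this
    cases h.2 <;> simp
  have hxy := a_mul_inv
  have hw := P.writhe_eq_virtualize hS
  rw [Fin.sum_univ_one] at hw
  have hk : ∀ i, D.kind (P.vert i) ≠ Kind.flat := by
    rintro i h0
    change D.kind (D.vertex h) = _ at h0
    simp [h0, Kind.isClassical] at hc
  have hloop : ∀ ρ, stateValue (D.Linked (P.insert ρ ![some false])) (flatMarks D.kind) =
      stateValue (Matched (P.base ρ) P.A P.B id) (P.outerMarks D.kind) * loopValue := by
    intro ρ
    rw [P.stateValue_insert _ _ (fun i h0 => (hk i h0).elim), P.marks_eq _ hk]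
    have : (![some false] : Fin 1 → Resolution) = fun _ => some false := by
      funext i; fin_cases i; rfl
    rw [this]
    exact stateValue_monogon_false _ _ _ _
  have harc : ∀ ρ, stateValue (D.Linked (P.insert ρ ![some true])) (flatMarks D.kind) =
      stateValue (Matched (P.base ρ) P.A P.B id) (P.outerMarks D.kind) := by
    intro ρ
    rw [P.stateValue_insert _ _ (fun i h0 => (hk i h0).elim), P.marks_eq _ hk]
    exact stateValue_monogon _ _ _ _ (by simp)
  have hnone : ∀ ρ, stateValue (Tangle (P.base ρ) P.A P.B P.prv fun _ => none)
      (fun v => Sum.inl '' P.outerMarks D.kind v) =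
      stateValue (Matched (P.base ρ) P.A P.B id) (P.outerMarks D.kind) :=
    fun ρ => stateValue_monogon _ _ _ _ (by simp)
  have hsum := fun ρ => sum_fin_one
    (fun i r => weight (D.kind (P.vert i)) (r.map (xor (P.corner i).1.2)))
    (fun τ => stateValue (D.Linked (P.insert ρ τ)) (flatMarks D.kind))
  rcases (isClassical_iff h).1 hc with ho | hu
  · have ho' : D.kind (P.vert 0) = Kind.classical (P.corner 0).1.2 := ho
    have hs : (D.kind (P.vert 0)).sign = 1 := by
      rw [ho']
      change (Kind.classical h.1.2).sign = 1
      rw [hx]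
      rfl
    rw [P.bracket_eq_virtualize hS (((-a) ^ (3 : ℤ) : CoeffRingˣ) : CoeffRing), ← mul_assoc,
      units_pow_mul hw (by rw [hs]; rfl)]
    intro ρ
    rw [hsum, ho', sum_weight_over, hloop, harc, hnone, loopValue_eq, zpow_ofNat,
      Units.val_pow_eq_pow_val, Units.val_neg]
    linear_combination (-((a⁻¹ : CoeffRingˣ) : CoeffRing) *
      stateValue (Matched (P.base ρ) P.A P.B id) (P.outerMarks D.kind)) * hxy
  · have hu' : D.kind (P.vert 0) = Kind.classical !(P.corner 0).1.2 := hu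
    have hs : (D.kind (P.vert 0)).sign = -1 := by
      rw [hu']
      change (Kind.classical !h.1.2).sign = -1
      rw [hx]
      rfl
    rw [P.bracket_eq_virtualize hS (((-a) ^ (-3 : ℤ) : CoeffRingˣ) : CoeffRing), ← mul_assoc,
      units_pow_mul hw (by rw [hs]; rfl)]
    intro ρ
    have hn : (-a : CoeffRingˣ)⁻¹ = -a⁻¹ :=
      inv_eq_of_mul_eq_one_right (Units.ext (by
        rw [Units.val_mul, Units.val_neg, Units.val_neg, neg_mul_neg, hxy, Units.val_one]))
    rw [hsum, hu', sum_weight_under, hloop, harc, hnone, loopValue_eq, zpow_neg, zpow_ofNat,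
      ← inv_pow, hn, Units.val_pow_eq_pow_val, Units.val_neg]
    linear_combination (-(a : CoeffRing) *
      stateValue (Matched (P.base ρ) P.A P.B id) (P.outerMarks D.kind)) * hxy

theorem mem_pair_iff_vert {h : D.HalfEdge} (hh : D.IsBigon h) (v : D.V) :
    v ∈ ({D.vertex h, D.vertex (D.face h)} : Set D.V) ↔
      ∃ i, v = (Polygon.bigon h hh).vert i := by
  simp [Polygon.bigon, Polygon.vert, Fin.exists_fin_two]

/-- Corner 0 is over and corner 1 is under. Three of the four smoothings give the identity matching
with total coefficient `δ + a² + a⁻² = 0`. The fourth has coefficient `a⁻¹a = 1` and the matching of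
the separated strands. -/
theorem ClassicalR2.polynomial_eq (hR : D.ClassicalR2 D') : D.polynomial = D'.polynomial := by
  obtain ⟨h, hh, ho, hu, ⟨e⟩⟩ := hR
  rw [← e.polynomial_virtualize, polynomial, polynomial]
  let P := Polygon.bigon h hh
  have hS := mem_pair_iff_vert hh
  have h0 : D.kind (P.vert 0) = Kind.classical (P.corner 0).1.2 := ho
  have h1 : D.kind (P.vert 1) = Kind.classical !(P.corner 1).1.2 := isOver_opp hu
  -- Going once around the bigon returns to the initial direction, so the two strand labels agree.
  -- One corner being over and the other under, the signs are opposite and cancel in the writhe.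
  have hx : (P.corner 0).1.2 = (P.corner 1).1.2 := by
    have k1 := D.face_snd h
    have k2 := D.face_snd (D.face h)
    rw [hh.1] at k2
    change h.1.2 = (D.face h).1.2
    rw [k1] at k2
    revert k2
    cases h.2 <;> cases h.1.2 <;> cases (D.face h).1.2 <;> simp
  have hxy := a_mul_inv
  have hw := P.writhe_eq_virtualize hS
  rw [Fin.sum_univ_two, h0, h1, hx] at hw
  have hw : D.writhe = (D.virtualize {D.vertex h, D.vertex (D.face h)}).writhe := by
    rw [hw]
    cases (P.corner 1).1.2 <;> simp [Kind.sign]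
  have hk : ∀ i, D.kind (P.vert i) ≠ Kind.flat := by
    intro i
    fin_cases i
    · exact fun h => by cases h0.symm.trans h
    · exact fun h => by cases h1.symm.trans h
  have hins : ∀ ρ τ, stateValue (D.Linked (P.insert ρ τ)) (flatMarks D.kind) =
      stateValue (Tangle (P.base ρ) P.A P.B ![1, 0] τ)
        (fun v => Sum.inl '' P.outerMarks D.kind v) := by
    intro ρ τ
    rw [P.stateValue_insert _ _ (fun i h0 => (hk i h0).elim), P.marks_eq _ hk]
    rfl
  rw [P.bracket_eq_virtualize hS 1, one_mul, hw]
  intro ρ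
  have hnone : (fun _ => none : Fin 2 → Resolution) = ![none, none] := by
    funext i; fin_cases i <;> rfl
  rw [sum_fin_two (fun i r => weight (D.kind (P.vert i)) (r.map (xor (P.corner i).1.2)))
    (fun τ => stateValue (D.Linked (P.insert ρ τ)) (flatMarks D.kind))]
  simp only [h0, h1, sum_weight_over, sum_weight_under, hins]
  change _ = 1 * stateValue (Tangle (P.base ρ) P.A P.B ![1, 0] _) _
  rw [hnone, stateValue_bigon_loop, stateValue_bigon _ _ _ _ ![P.A 1, P.A 1] id (by simp),
    stateValue_bigon _ _ _ _ ![P.A 0, P.A 0] id (by simp),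
    stateValue_bigon _ _ _ _ P.A ![1, 0] (by simp),
    stateValue_bigon _ _ _ _ P.B ![1, 0] (by simp), loopValue_eq]
  linear_combination (stateValue (Matched (P.base ρ) P.A P.B ![1, 0]) (P.outerMarks D.kind) -
    stateValue (Matched (P.base ρ) P.A P.B id) (P.outerMarks D.kind) *
      ((a : CoeffRing) ^ 2 + ((a⁻¹ : CoeffRingˣ) : CoeffRing) ^ 2)) * hxy

/-- Both corners lie on the same two sides, so they meet the same components and may be unmarked
together; the matching is that of virtual corners. -/
theorem FlatR2.polynomial_eq (hR : D.FlatR2 D') : D.polynomial = D'.polynomial := by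
  obtain ⟨h, hh, h0, h1, ⟨e⟩⟩ := hR
  rw [← e.polynomial_virtualize, polynomial, polynomial]
  let P := Polygon.bigon h hh
  have hS := mem_pair_iff_vert hh
  have h0 : D.kind (P.vert 0) = Kind.flat := h0
  have h1 : D.kind (P.vert 1) = Kind.flat := h1
  have hw := P.writhe_eq_virtualize hS
  rw [Fin.sum_univ_two, h0, h1, Kind.sign, add_zero, add_zero] at hw
  rw [P.bracket_eq_virtualize hS 1, one_mul, hw]
  intro ρ
  have hnone : (fun _ => none : Fin 2 → Resolution) = ![none, none] := by
    funext i; fin_cases i <;> rfl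
  rw [sum_fin_two (fun i r => weight (D.kind (P.vert i)) (r.map (xor (P.corner i).1.2)))
    (fun τ => stateValue (D.Linked (P.insert ρ τ)) (flatMarks D.kind))]
  simp only [h0, h1, sum_weight_flat]
  rw [P.stateValue_insert, hnone, one_mul,
    P.stateValue_unmark_corners D.kind _ (i := 0) (j := 1) (by simp) h0 h1 _ rfl rfl]
  · intro l hl hl'
    fin_cases l <;> simp at hl hl'
  · intro i _
    fin_cases i <;> rfl

end FlatVirtual.SurfaceDiagram

/-! ### The slid triangle and its outer ends -/

namespace FlatVirtual.SurfaceDiagram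

variable {D D' : SurfaceDiagram} (h : D.HalfEdge)

namespace Polygon

variable (hh : D.IsTriangle h)

/-- The two passages joined by each side of a triangle are interchanged. -/
def sidesSwap : Equiv.Perm D.Passage :=
  D.edgeSwap h * D.edgeSwap (D.face h) * D.edgeSwap (D.face (D.face h))

variable {h}

theorem sidesSwap_of_ne {p : D.Passage} (hp : ∀ i, p.1 ≠ (triangle h hh).vert i) :
    sidesSwap h p = p := by
  have key : ∀ i, D.edgeSwap ((triangle h hh).corner i) p = p := by
    intro i
    refine Equiv.swap_apply_of_ne_of_ne ?_ ?_
    · rintro rfl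
      exact hp i rfl
    · rintro rfl
      obtain ⟨j, rfl⟩ := (triangle h hh).surjective i
      refine hp j ?_
      rw [opp_strand, face_eq]
      rfl
  have k0 := key 0
  have k1 := key 1
  have k2 := key 2
  change D.edgeSwap h p = p at k0
  change D.edgeSwap (D.face h) p = p at k1
  change D.edgeSwap (D.face (D.face h)) p = p at k2
  simp [sidesSwap, k0, k1, k2]

/-- The vertices are distinct, so the transpositions are disjoint and act independently. -/
theorem swap_triple {V : Type} [DecidableEq V] {u v w : V} (huv : u ≠ v) (hvw : v ≠ w)
    (hwu : w ≠ u) (x y z : Bool) (τ : Equiv.Perm (V × Bool))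
    (hτ : τ = Equiv.swap (u, x) (v, !y) * Equiv.swap (v, y) (w, !z) * Equiv.swap (w, z) (u, !x)) :
    (τ (u, x) = (v, !y) ∧ τ (v, !y) = (u, x)) ∧ (τ (v, y) = (w, !z) ∧ τ (w, !z) = (v, y)) ∧
      (τ (w, z) = (u, !x) ∧ τ (u, !x) = (w, z)) := by
  subst hτ
  simp [Equiv.swap_apply_def, huv, hvw, hwu, huv.symm, hvw.symm, hwu.symm]

theorem sidesSwap_corner (i : Fin 3) :
    sidesSwap h ((triangle h hh).corner i).1 = (D.opp ((triangle h hh).corner i)).1 ∧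
      sidesSwap h (D.opp ((triangle h hh).corner i)).1 = ((triangle h hh).corner i).1 := by
  have h1 := D.opp_strand h
  have h2 := D.opp_strand (D.face h)
  have h3 := D.opp_strand (D.face (D.face h))
  rw [hh.1] at h3
  obtain ⟨k1, k2, k3⟩ := swap_triple hh.2.1 hh.2.2.1 hh.2.2.2 h.1.2 (D.face h).1.2
    (D.face (D.face h)).1.2 (sidesSwap h) (by
      unfold sidesSwap edgeSwap
      rw [h1, h2, h3]
      rfl)
  fin_cases i
  · exact ⟨k1.1.trans h1.symm, (congrArg _ h1).trans k1.2⟩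
  · exact ⟨k2.1.trans h2.symm, (congrArg _ h2).trans k2.2⟩
  · exact ⟨k3.1.trans h3.symm, (congrArg _ h3).trans k3.2⟩

theorem sidesSwap_vertex {p : D.Passage} {i : Fin 3} (hp : p.1 = (triangle h hh).vert i) :
    p = ((triangle h hh).corner i).1 ∨
      p = (D.opp ((triangle h hh).corner ((triangle h hh).prv i))).1 := by
  rw [opp_corner, rot_symm_strand]
  obtain ⟨v, x⟩ := p
  cases hp
  by_cases hx : x = ((triangle h hh).corner i).1.2
  · exact .inl (by rw [hx])
  · refine .inr (Prod.ext rfl ?_)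
    revert hx
    cases x <;> simp

theorem sidesSwap_sidesSwap (hh : D.IsTriangle h) (p : D.Passage) :
    sidesSwap h (sidesSwap h p) = p := by
  by_cases hp : ∀ i, p.1 ≠ (triangle h hh).vert i
  · rw [sidesSwap_of_ne hh hp, sidesSwap_of_ne hh hp]
  · push Not at hp
    obtain ⟨i, hi⟩ := hp
    rcases sidesSwap_vertex hh hi with rfl | rfl
    · rw [(sidesSwap_corner hh _).1, (sidesSwap_corner hh _).2]
    · rw [(sidesSwap_corner hh _).2, (sidesSwap_corner hh _).1]

/-- The half-edge of `D` that takes the place of a half-edge of `D.slide h`. -/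
def pull (h x : D.HalfEdge) : D.HalfEdge := (sidesSwap h x.1, x.2)

theorem pull_pull (hh : D.IsTriangle h) (x : D.HalfEdge) : pull h (pull h x) = x :=
  Prod.ext (sidesSwap_sidesSwap hh x.1) rfl

theorem pull_of_ne {x : D.HalfEdge} (hx : ∀ i, x.1.1 ≠ (triangle h hh).vert i) : pull h x = x :=
  Prod.ext (sidesSwap_of_ne hh hx) rfl

/-- Sliding conjugates `next` by the involution `sidesSwap`, hence `opp` by `pull`, while the
rotation at each vertex is unchanged. -/
theorem opp_slide (hh : D.IsTriangle h) (x : D.HalfEdge) :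
    (D.slide h).opp x = pull h (D.opp (pull h x)) := by
  have hs : (sidesSwap h)⁻¹ = sidesSwap h :=
    inv_eq_of_mul_eq_one_right (Equiv.ext (sidesSwap_sidesSwap hh))
  have hn : (D.slide h).next = sidesSwap h * D.next * sidesSwap h := by
    conv_rhs => rw [← hs, hs]
    nth_rw 2 [← hs]
    rfl
  have hn' : (D.slide h).next.symm = sidesSwap h * D.next.symm * sidesSwap h := by
    refine (congrArg (fun f : Equiv.Perm D.Passage => f⁻¹) hn).trans ?_
    simp only [mul_inv_rev, hs, mul_assoc]
    rfl
  obtain ⟨p, _ | _⟩ := x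
  · exact Prod.ext (congrArg (fun f : Equiv.Perm D.Passage => f p) hn') rfl
  · exact Prod.ext (congrArg (fun f : Equiv.Perm D.Passage => f p) hn) rfl

theorem rot_slide (x : D.HalfEdge) : (D.slide h).rot x = D.rot x := by
  obtain ⟨⟨v, _ | _⟩, o⟩ := x <;> rfl

theorem pull_corner (i : Fin 3) : pull h ((triangle h hh).corner i) =
    D.rot (D.rot (D.opp ((triangle h hh).corner i))) := by
  rw [rot_rot, opp_snd, Bool.not_not, pull, (sidesSwap_corner hh i).1]

theorem pull_opp_corner (i : Fin 3) : pull h (D.opp ((triangle h hh).corner i)) =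
    D.rot (D.rot ((triangle h hh).corner i)) := by
  rw [rot_rot, pull, (sidesSwap_corner hh i).2, opp_snd]

theorem pull_rot_rot (i : Fin 3) : pull h (D.rot (D.rot ((triangle h hh).corner i))) =
    D.opp ((triangle h hh).corner i) := by
  rw [← pull_opp_corner, pull_pull hh]

/-- The triangle on the other side after a third Reidemeister move. -/
def slideTriangle : Polygon (D.slide h) (Fin 3) where
  -- At every vertex the new triangle occupies the angle opposite to the old one.
  corner i := D.rot (D.rot ((triangle h hh).corner i))
  prv := (triangle h hh).prv
  surjective := (triangle h hh).surjective
  face_eq i := by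
    refine (rot_slide (h := h) ((D.slide h).opp _)).trans ?_
    rw [opp_slide hh, pull_rot_rot, opp_opp, pull_corner, opp_corner, Equiv.apply_symm_apply]
  injective i j hij := by
    refine (triangle h hh).injective ?_
    simp only [vertex, rot_rot] at hij
    exact hij

theorem slideTriangle_corner_iff (x : D.HalfEdge) :
    (∃ i, x = (slideTriangle hh).corner i ∨ (D.slide h).opp x = (slideTriangle hh).corner i) ↔
      ∃ i, pull h x = (triangle h hh).corner i ∨ D.opp (pull h x) = (triangle h hh).corner i := by
  refine exists_congr fun i => ?_
  have h1 : x = (slideTriangle hh).corner i ↔ D.opp (pull h x) = (triangle h hh).corner i := by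
    change x = D.rot (D.rot ((triangle h hh).corner i)) ↔ _
    rw [← pull_opp_corner]
    constructor
    · rintro rfl
      rw [pull_pull hh, opp_opp]
    · intro h
      rw [← h, opp_opp, pull_pull hh]
  have h2 : (D.slide h).opp x = (slideTriangle hh).corner i ↔
      pull h x = (triangle h hh).corner i := by
    rw [opp_slide hh]
    change _ = D.rot (D.rot ((triangle h hh).corner i)) ↔ _
    rw [← pull_opp_corner]
    constructor
    · intro h'
      have := congrArg (fun y => D.opp (pull h y)) h'
      simpa only [pull_pull hh, opp_opp] using this
    · intro h'
      rw [h']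
  rw [h1, h2, or_comm]

/-- The identification of the outer half-edges. -/
def outerEquiv : (slideTriangle hh).Outer ≃ (triangle h hh).Outer where
  toFun x := ⟨pull h x.1, fun hx => x.2 ((slideTriangle_corner_iff hh x.1).2 hx)⟩
  invFun x := ⟨pull (D := D) h x.1, fun hx => x.2 (by
    have := (slideTriangle_corner_iff hh (pull (D := D) h x.1)).1 hx
    rwa [pull_pull hh] at this)⟩
  left_inv x := Subtype.ext (pull_pull hh x.1)
  right_inv x := Subtype.ext (pull_pull hh x.1)

theorem slideTriangle_vert (i : Fin 3) : (slideTriangle hh).vert i = (triangle h hh).vert i := by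
  change (D.rot (D.rot ((triangle h hh).corner i))).1.1 = _
  rw [rot_rot]
  rfl

theorem slideTriangle_types (ρ : D.V → Resolution) :
    (slideTriangle hh).types ρ = (triangle h hh).types ρ := by
  funext i
  change Option.map _ (ρ (D.rot (D.rot ((triangle h hh).corner i))).1.1) = _
  change Option.map (xor (D.rot (D.rot ((triangle h hh).corner i))).1.2) _ = _
  rw [rot_rot]
  rfl

/-- The half-edge at the vertex `i` that used to belong to the side `prv i` now leads outwards,
replacing the end at the far vertex of that side. The index vector is `prv`, and its inverse occurs
for `B`. -/
theorem outerEquiv_A (i : Fin 3) :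
    outerEquiv hh ((slideTriangle hh).A i) = (triangle h hh).B (![2, 0, 1] i) := by
  refine Subtype.ext ?_
  change pull h ((D.slide h).rot (D.rot (D.rot ((triangle h hh).corner i)))) = _
  rw [rot_slide, rot_rot_rot, ← opp_corner, pull_opp_corner]
  rfl

theorem outerEquiv_B (i : Fin 3) :
    outerEquiv hh ((slideTriangle hh).B i) = (triangle h hh).A (![1, 2, 0] i) := by
  refine Subtype.ext ?_
  change pull h ((D.slide h).rot ((D.slide h).rot (D.rot (D.rot ((triangle h hh).corner i))))) = _
  have hi : i = (triangle h hh).prv (![1, 2, 0] i) := by fin_cases i <;> rfl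
  rw [rot_slide, rot_slide, rot_rot_rot, Equiv.symm_apply_apply, pull_corner, hi, opp_corner,
    Equiv.apply_symm_apply, ← hi]
  rfl

theorem pull_vertex_iff (x : D.HalfEdge) : (∀ i, (pull h x).1.1 ≠ (triangle h hh).vert i) ↔
    ∀ i, x.1.1 ≠ (triangle h hh).vert i := by
  constructor
  · intro hx
    have := pull_of_ne hh hx
    rw [pull_pull hh] at this
    rw [this]
    exact hx
  · intro hx
    rwa [pull_of_ne hh hx]

theorem base_pull (ρ : D.V → Resolution) (x y : D.HalfEdge) :
    (y = (D.slide h).opp x ∨ (∀ i, x.1.1 ≠ (triangle h hh).vert i) ∧ y = turn ρ x) ↔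
      (pull h y = D.opp (pull h x) ∨ (∀ i, (pull h x).1.1 ≠ (triangle h hh).vert i) ∧
        pull h y = turn ρ (pull h x)) := by
  have hinj : Function.Injective (pull h) := (Function.LeftInverse.injective (pull_pull hh))
  refine or_congr ?_ ?_
  · rw [opp_slide hh]
    constructor
    · intro h'
      rw [h', pull_pull hh]
    · intro h'
      rw [← h', pull_pull hh]
  · rw [pull_vertex_iff hh]
    refine and_congr_right fun hk => ?_
    rw [pull_of_ne hh hk]
    have : pull h (turn ρ x) = turn ρ x := pull_of_ne hh (by rwa [turn_vertex])
    constructor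
    · intro h'
      rw [h', this]
    · intro h'
      exact hinj (h'.trans this.symm)

theorem base_outerEquiv (ρ : D.V → Resolution) (k l : (slideTriangle hh).Outer) :
    (slideTriangle hh).base ρ k l ↔
      (triangle h hh).base ρ (outerEquiv hh k) (outerEquiv hh l) := by
  refine Iff.trans (or_congr_right (and_congr_left' (forall_congr' fun i => ?_)))
    (base_pull hh ρ k.1 l.1)
  rw [slideTriangle_vert]
  exact Iff.rfl

end Polygon

theorem stateValue_tangle_map {K K' V ι : Type} [Finite K] [Finite ι] {base : K → K → Prop}
    {base' : K' → K' → Prop} {A B : ι → K} {A' B' : ι → K'} {prv : ι → ι} {τ : ι → Resolution}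
    {m : V → Set (K ⊕ ι)} {m' : V → Set (K' ⊕ ι)}
    (e : K ≃ K') (hb : ∀ k l, base k l ↔ base' (e k) (e l)) (hA : ∀ i, e (A i) = A' i)
    (hB : ∀ i, e (B i) = B' i) (hm : ∀ v x, x ∈ m v ↔ Sum.map e id x ∈ m' v) :
    stateValue (Tangle base A B prv τ) m = stateValue (Tangle base' A' B' prv τ) m' := by
  have : Finite K' := Finite.of_equiv K e
  obtain rfl : A' = fun i => e (A i) := funext fun i => (hA i).symm
  obtain rfl : B' = fun i => e (B i) := funext fun i => (hB i).symm
  have hs : Function.Surjective (Sum.map e id : K ⊕ ι → K' ⊕ ι) :=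
    Sum.map_surjective.2 ⟨e.surjective, Function.surjective_id⟩
  have hi : Function.Injective (Sum.map e id : K ⊕ ι → K' ⊕ ι) :=
    Sum.map_injective.2 ⟨e.injective, Function.injective_id⟩
  refine stateValue_eq_of_surjective (Equiv.refl _) (Sum.map e id) hs ?_ ?_ ?_ ?_ ?_
  · exact Tangle.lift_eq _ (fun k l h => Quot.sound (.base _ _ ((hb k l).1 h)))
      (fun i => Tangle.cornerJoins base' (fun i => e (A i)) (fun i => e (B i)) prv τ i)
  · exact fun x y h => congrArg _ (hi h)
  · rintro _ _ (⟨k, l, h⟩ | ⟨i, h⟩ | ⟨i, h⟩ | ⟨i, h⟩ | ⟨i, h⟩ | ⟨i, h⟩ | ⟨i, h⟩)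
    · obtain ⟨k, rfl⟩ := e.surjective k
      obtain ⟨l, rfl⟩ := e.surjective l
      exact ⟨.inl k, .inl l, rfl, rfl, Quot.sound (.base _ _ ((hb k l).2 h))⟩
    · exact ⟨.inr i, .inl (B i), rfl, rfl, Quot.sound (.straight i h)⟩
    · exact ⟨.inr (prv i), .inl (A i), rfl, rfl, Quot.sound (.straight_prv i h)⟩
    · exact ⟨.inr i, .inr (prv i), rfl, rfl, Quot.sound (.inner i h)⟩
    · exact ⟨.inl (A i), .inl (B i), rfl, rfl, Quot.sound (.outer i h)⟩
    · exact ⟨.inr i, .inl (A i), rfl, rfl, Quot.sound (.turn i h)⟩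
    · exact ⟨.inr (prv i), .inl (B i), rfl, rfl, Quot.sound (.turn_prv i h)⟩
  · exact fun v x hx => ⟨_, (hm v x).1 hx, rfl⟩
  · intro v y hy
    obtain ⟨x, rfl⟩ := hs y
    exact ⟨x, (hm v x).2 hy, rfl⟩

namespace Polygon

variable {h} (hh : D.IsTriangle h)

/-- Before and after the move there are tangles with the same outside, corner types and marks; only
the positions of the outer ends differ. -/
theorem stateValue_slide (ρ : D.V → Resolution) (τ : Fin 3 → Resolution) {κ : D.V → Kind}
    (hτ : ∀ i, κ ((triangle h hh).vert i) = Kind.flat → τ i = none) :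
    stateValue ((D.slide h).Linked ((triangle h hh).insert ρ τ)) (flatMarks κ) =
      stateValue (Tangle ((triangle h hh).base ρ) (fun i => (triangle h hh).B (![2, 0, 1] i))
        (fun i => (triangle h hh).A (![1, 2, 0] i)) ![2, 0, 1] τ) ((triangle h hh).marks κ) := by
  have h1 := (slideTriangle hh).stateValue_eq κ ((triangle h hh).insert ρ τ) (by
    intro i hi
    rw [slideTriangle_vert] at hi ⊢
    rw [insert_vert, hτ i hi, Option.map_none])
  refine h1.trans ?_
  rw [slideTriangle_types, types_insert, ← (triangle h hh).base_insert ρ τ]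
  refine stateValue_tangle_map (outerEquiv hh) (base_outerEquiv hh _) (outerEquiv_A hh)
    (outerEquiv_B hh) ?_
  rintro v (k | i)
  · refine and_congr_right fun hv => or_congr ?_ ?_
    · constructor
      · rintro ⟨k', hk, rfl, hv⟩
        cases hk
        simp only [slideTriangle_vert] at hv
        refine ⟨outerEquiv hh k, rfl, ?_, hv⟩
        exact congrArg (fun y => y.1.1) (pull_of_ne hh hv)
      · rintro ⟨k', hk, rfl, hv⟩
        cases hk
        have hv' := (pull_vertex_iff hh k.1).1 hv
        refine ⟨k, rfl, ?_, fun i => by rw [slideTriangle_vert]; exact hv i⟩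
        exact (congrArg (fun y => y.1.1) (pull_of_ne hh hv')).symm
    · simp
  · refine and_congr_right fun hv => or_congr ?_ ?_
    · simp
    · simp only [slideTriangle_vert]
      refine exists_congr fun j => and_congr_right fun _ => ?_
      refine or_congr ?_ ?_
      · simp
      · simp [slideTriangle]

end Polygon

end FlatVirtual.SurfaceDiagram

/-! ### The third Reidemeister moves -/

namespace FlatVirtual.SurfaceDiagram

variable {D D' : SurfaceDiagram} {h : D.HalfEdge}

open FlatVirtual.SurfaceDiagram.Polygon

theorem polynomial_slide (hh : D.IsTriangle h)
    (H : ∀ ρ, ∑ τ : Fin 3 → Resolution,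
        (∏ i, weight (D.kind ((triangle h hh).vert i))
          ((τ i).map (xor ((triangle h hh).corner i).1.2))) *
          stateValue (D.Linked ((triangle h hh).insert ρ τ)) (flatMarks D.kind) =
      ∑ τ : Fin 3 → Resolution,
        (∏ i, weight (D.kind ((triangle h hh).vert i))
          ((τ i).map (xor ((triangle h hh).corner i).1.2))) *
          stateValue ((D.slide h).Linked ((triangle h hh).insert ρ τ)) (flatMarks D.kind)) :
    D.polynomial = (D.slide h).polynomial := by
  have key := (triangle h hh).sum_congr (k := D.kind) (k' := D.kind) (fun _ _ => rfl)
    (W := fun ρ => stateValue (D.Linked ρ) (flatMarks D.kind))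
    (W' := fun ρ => stateValue ((D.slide h).Linked ρ) (flatMarks D.kind)) 1
    (fun ρ => (H ρ).trans (one_mul _).symm)
  rw [one_mul] at key
  exact congrArg (fun x => (((-a) ^ (-3 * D.writhe) : CoeffRingˣ) : CoeffRing) *
    (loopValue ^ D.circles * x)) key

/-- After expansion, the matchings that are transpositions are fixed by the slide, while the
identity and the 3-cycle are interchanged and have equal coefficients. -/
theorem ClassicalR3.polynomial_eq (hR : D.ClassicalR3 D') : D.polynomial = D'.polynomial := by
  obtain ⟨h, hh, -, -, hc, ⟨ho, hu⟩, -, ⟨i⟩⟩ := hR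
  rw [← i.polynomial_eq]
  apply polynomial_slide hh
  intro ρ
  have h0 : D.kind ((triangle h hh).vert 0) = Kind.classical ((triangle h hh).corner 0).1.2 := ho
  have h1 : D.kind ((triangle h hh).vert 1) = Kind.classical !((triangle h hh).corner 1).1.2 :=
    isOver_opp hu
  have h2 : D.kind ((triangle h hh).vert 2) = Kind.classical ((triangle h hh).corner 2).1.2 ∨
    D.kind ((triangle h hh).vert 2) = Kind.classical !((triangle h hh).corner 2).1.2 :=
    (isClassical_iff _).1 hc
  have hk : ∀ i, D.kind ((triangle h hh).vert i) ≠ Kind.flat := by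
    intro i h'
    fin_cases i
    · cases h0.symm.trans h'
    · cases h1.symm.trans h'
    · rcases h2 with h2 | h2 <;> cases h2.symm.trans h'
  have hins : ∀ τ, stateValue (D.Linked ((triangle h hh).insert ρ τ)) (flatMarks D.kind) =
      stateValue (Tangle ((triangle h hh).base ρ) (triangle h hh).A (triangle h hh).B ![2, 0, 1] τ)
        (fun v => Sum.inl '' (triangle h hh).outerMarks D.kind v) := by
    intro τ
    rw [stateValue_insert _ _ _ (fun i h0 => (hk i h0).elim), marks_eq _ _ hk]
    rfl
  have hslide : ∀ τ, stateValue ((D.slide h).Linked ((triangle h hh).insert ρ τ))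
        (flatMarks D.kind) =
      stateValue (Tangle ((triangle h hh).base ρ) (fun i => (triangle h hh).B (![2, 0, 1] i))
        (fun i => (triangle h hh).A (![1, 2, 0] i)) ![2, 0, 1] τ)
        (fun v => Sum.inl '' (triangle h hh).outerMarks D.kind v) := by
    intro τ
    rw [stateValue_slide _ _ _ (fun i h0 => (hk i h0).elim), marks_eq _ _ hk]
  have hxy := a_mul_inv
  rw [sum_fin_three (fun i r => weight (D.kind ((triangle h hh).vert i))
      (r.map (xor ((triangle h hh).corner i).1.2)))
      (fun τ => stateValue (D.Linked ((triangle h hh).insert ρ τ)) (flatMarks D.kind)),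
    sum_fin_three (fun i r => weight (D.kind ((triangle h hh).vert i))
      (r.map (xor ((triangle h hh).corner i).1.2)))
      (fun τ => stateValue ((D.slide h).Linked ((triangle h hh).insert ρ τ)) (flatMarks D.kind))]
  -- Here `p` and `q` are the weights of joining and not joining the sides at corner 2, where either
  -- crossing type may occur. In the `p` part the other two corners behave as in the second move:
  -- the identity matchings cancel and one transposition remains. The `q` part has no closed loop.
  have eval : ∀ (A B : Fin 3 → (triangle h hh).Outer)
      (f : Resolution → Resolution → Resolution → CoeffRing), (∀ x y z, f x y z =
        stateValue (Tangle ((triangle h hh).base ρ) A B ![2, 0, 1] ![x, y, z])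
          (fun v => Sum.inl '' (triangle h hh).outerMarks D.kind v)) →
      ∀ p q : CoeffRing,
      a * (((a⁻¹ : CoeffRingˣ) : CoeffRing) *
            (p * f (some false) (some false) (some false) +
              q * f (some false) (some false) (some true)) +
          a * (p * f (some false) (some true) (some false) +
              q * f (some false) (some true) (some true))) +
        ((a⁻¹ : CoeffRingˣ) : CoeffRing) * (((a⁻¹ : CoeffRingˣ) : CoeffRing) *
            (p * f (some true) (some false) (some false) +
              q * f (some true) (some false) (some true)) +
          a * (p * f (some true) (some true) (some false) +
              q * f (some true) (some true) (some true))) =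
      p * stateValue (Matched ((triangle h hh).base ρ) A B ![1, 0, 2])
          ((triangle h hh).outerMarks D.kind) +
        q * (stateValue (Matched ((triangle h hh).base ρ) A B id)
            ((triangle h hh).outerMarks D.kind) +
          (a : CoeffRing) ^ 2 * stateValue (Matched ((triangle h hh).base ρ) A B ![0, 2, 1])
            ((triangle h hh).outerMarks D.kind) +
          ((a⁻¹ : CoeffRingˣ) : CoeffRing) ^ 2 *
            stateValue (Matched ((triangle h hh).base ρ) A B ![2, 1, 0])
            ((triangle h hh).outerMarks D.kind) +
          stateValue (Matched ((triangle h hh).base ρ) A B ![1, 2, 0])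
            ((triangle h hh).outerMarks D.kind)) := by
    intro A B f hf p q
    simp only [hf]
    rw [stateValue_triangle_loop,
      stateValue_triangle _ _ _ _ ![A 2, A 2, A 2] id (by simp),
      stateValue_triangle _ _ _ _ ![A 1, A 1, A 1] id (by simp),
      stateValue_triangle _ _ _ _ ![A 2, A 1, A 2] ![0, 2, 1] (by simp),
      stateValue_triangle _ _ _ _ ![A 0, A 0, A 0] id (by simp),
      stateValue_triangle _ _ _ _ ![A 0, A 0, A 2] ![2, 1, 0] (by simp),
      stateValue_triangle _ _ _ _ ![A 0, A 1, A 1] ![1, 0, 2] (by simp),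
      stateValue_triangle _ _ _ _ A ![1, 2, 0] (by simp), loopValue_eq]
    generalize stateValue (Matched _ A B id) _ = M0
    generalize stateValue (Matched _ A B ![1, 0, 2]) _ = M1
    generalize stateValue (Matched _ A B ![1, 2, 0]) _ = M2
    linear_combination (p * (M1 - M0 * ((a : CoeffRing) ^ 2 +
      ((a⁻¹ : CoeffRingˣ) : CoeffRing) ^ 2)) + q * (M0 + M2)) * hxy
  rcases h2 with h2 | h2
  all_goals
    simp only [h0, h1, h2, sum_weight_over, sum_weight_under]
    rw [eval _ _ (fun x y z => stateValue (D.Linked ((triangle h hh).insert ρ ![x, y, z]))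
        (flatMarks D.kind)) (fun x y z => hins _),
      eval _ _ (fun x y z => stateValue ((D.slide h).Linked ((triangle h hh).insert ρ ![x, y, z]))
        (flatMarks D.kind)) (fun x y z => hslide _),
      stateValue_matched_slide _ _ _ _ ![1, 0, 2] ![1, 0, 2] (by simp),
      stateValue_matched_slide _ _ _ _ ![1, 2, 0] id (by simp),
      stateValue_matched_slide _ _ _ _ ![0, 2, 1] ![0, 2, 1] (by simp),
      stateValue_matched_slide _ _ _ _ ![2, 1, 0] ![2, 1, 0] (by simp),
      stateValue_matched_slide _ _ _ _ id ![1, 2, 0] (by simp)]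
    ring

/-- Used when two tangles have the same connections after a renaming `φ` of the sides and a renaming
`π` of the marked vertices. -/
theorem stateValue_tangle_congr {K V ι : Type} [Finite K] [Finite ι] {base : K → K → Prop}
    {A B A' B' : ι → K} {prv : ι → ι} {τ τ' : ι → Resolution} {m : V → Set (K ⊕ ι)}
    (π : Equiv.Perm V) (φ : Equiv.Perm ι)
    (h : ∀ i, CornerJoins (Quot.mk (Tangle base A' B' prv τ') (.inr (φ i)))
      (Quot.mk (Tangle base A' B' prv τ') (.inr (φ (prv i))))
      (Quot.mk (Tangle base A' B' prv τ') (.inl (A i)))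
      (Quot.mk (Tangle base A' B' prv τ') (.inl (B i))) (τ i))
    (h' : ∀ i, CornerJoins (Quot.mk (Tangle base A B prv τ) (.inr (φ.symm i)))
      (Quot.mk (Tangle base A B prv τ) (.inr (φ.symm (prv i))))
      (Quot.mk (Tangle base A B prv τ) (.inl (A' i)))
      (Quot.mk (Tangle base A B prv τ) (.inl (B' i))) (τ' i))
    (hm : ∀ v x, x ∈ m v ↔ Sum.map id φ x ∈ m (π v)) :
    stateValue (Tangle base A B prv τ) m = stateValue (Tangle base A' B' prv τ') m := by
  have hs : Function.Surjective (Sum.map id φ : K ⊕ ι → K ⊕ ι) :=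
    Sum.map_surjective.2 ⟨Function.surjective_id, φ.surjective⟩
  have hi : Function.Injective (Sum.map id φ : K ⊕ ι → K ⊕ ι) :=
    Sum.map_injective.2 ⟨Function.injective_id, φ.injective⟩
  refine stateValue_eq_of_surjective π (Sum.map id φ) hs ?_ ?_ ?_ ?_ ?_
  · exact Tangle.lift_eq _ (fun k l h => Quot.sound (.base _ _ h)) h
  · exact fun x y h => congrArg _ (hi h)
  · intro u w huw
    refine ⟨Sum.map id φ.symm u, Sum.map id φ.symm w, ?_, ?_, ?_⟩
    · cases u <;> simp
    · cases w <;> simp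
    · exact Tangle.lift_eq (fun x => Quot.mk (Tangle base A B prv τ) (Sum.map id φ.symm x))
        (fun k l h => Quot.sound (.base _ _ h)) h' u w huw
  · exact fun v x hx => ⟨_, (hm v x).1 hx, rfl⟩
  · intro v y hy
    obtain ⟨x, rfl⟩ := hs y
    exact ⟨x, (hm v x).2 hy, rfl⟩

/-- Going straight, every side is joined to the same two outer ends before and after the slide, and
the flat corner `i` marks the sides `i` and `prv i` in both cases. -/
theorem FlatR3.polynomial_eq (hR : D.FlatR3 D') : D.polynomial = D'.polynomial := by
  obtain ⟨h, hh, h0, h1, h2, ⟨i⟩⟩ := hR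
  rw [← i.polynomial_eq]
  apply polynomial_slide hh
  intro ρ
  have hk : ∀ i, D.kind ((triangle h hh).vert i) = Kind.flat := by
    intro i
    fin_cases i
    exacts [h0, h1, h2]
  refine Finset.sum_congr rfl fun τ _ => ?_
  by_cases hτ : ∀ i, τ i = none
  · congr 1
    rw [stateValue_insert _ _ _ fun i _ => hτ i, stateValue_slide _ _ _ fun i _ => hτ i]
    obtain rfl : τ = fun _ => none := funext hτ
    refine stateValue_tangle_congr (Equiv.refl _) (Equiv.refl _) ?_ ?_ (by simp)
    · have := Tangle.cornerJoins ((triangle h hh).base ρ)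
        (fun i => (triangle h hh).B (![2, 0, 1] i)) (fun i => (triangle h hh).A (![1, 2, 0] i))
        ![2, 0, 1] (fun _ => none)
      intro i
      fin_cases i
      exacts [⟨(this 1).2, (this 2).1⟩, ⟨(this 2).2, (this 0).1⟩, ⟨(this 0).2, (this 1).1⟩]
    · have := Tangle.cornerJoins ((triangle h hh).base ρ) (triangle h hh).A (triangle h hh).B
        ![2, 0, 1] (fun _ => none)
      intro i
      fin_cases i
      exacts [⟨(this 1).2, (this 2).1⟩, ⟨(this 2).2, (this 0).1⟩, ⟨(this 0).2, (this 1).1⟩]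
  · push Not at hτ
    obtain ⟨i, hi⟩ := hτ
    rw [Finset.prod_eq_zero (Finset.mem_univ i), zero_mul, zero_mul]
    rw [hk]
    cases h : τ i
    · exact (hi h).elim
    · rfl

/-- The two smoothings of the classical corner are compared separately, so its over-under structure
enters only through a common weight. -/
theorem MixedR3.polynomial_eq (hR : D.MixedR3 D') : D.polynomial = D'.polynomial := by
  classical
  obtain ⟨h, hh, h0, h1, h2, ⟨i⟩⟩ := hR
  rw [← i.polynomial_eq]
  apply polynomial_slide hh
  intro ρ
  have h0 : D.kind ((triangle h hh).vert 0) = Kind.flat := h0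
  have h1 : D.kind ((triangle h hh).vert 1) = Kind.flat := h1
  have hc : (D.kind ((triangle h hh).vert 2)).isClassical = true := h2
  have h2 : D.kind ((triangle h hh).vert 2) ≠ Kind.flat := fun h' => by
    simp [h', Kind.isClassical] at hc
  have hτ : ∀ z i, D.kind ((triangle h hh).vert i) = Kind.flat →
      (![none, none, z] : Fin 3 → Resolution) i = none := by
    intro z i hi
    fin_cases i
    · rfl
    · rfl
    · exact (h2 hi).elim
  rw [sum_fin_three (fun i r => weight (D.kind ((triangle h hh).vert i))
      (r.map (xor ((triangle h hh).corner i).1.2)))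
      (fun τ => stateValue (D.Linked ((triangle h hh).insert ρ τ)) (flatMarks D.kind)),
    sum_fin_three (fun i r => weight (D.kind ((triangle h hh).vert i))
      (r.map (xor ((triangle h hh).corner i).1.2)))
      (fun τ => stateValue ((D.slide h).Linked ((triangle h hh).insert ρ τ)) (flatMarks D.kind))]
  simp only [h0, h1, sum_weight_flat, stateValue_insert _ _ _ (hτ _),
    stateValue_slide _ _ _ (hτ _)]
  refine Finset.sum_congr rfl fun z _ => ?_
  rcases z with _ | _ | _
  · have hw : weight (D.kind ((triangle h hh).vert 2)) none = 0 := by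
      revert hc
      cases D.kind ((triangle h hh).vert 2) <;> simp [Kind.isClassical, weight]
    rw [Option.map_none, hw, zero_mul, zero_mul]
  all_goals
    refine congrArg _ ?_
    change stateValue (Tangle _ _ _ ![2, 0, 1] _) _ = _
  · have key : ∀ A B : Fin 3 → (triangle h hh).Outer,
        stateValue (Tangle ((triangle h hh).base ρ) A B ![2, 0, 1] ![none, none, some false])
            ((triangle h hh).marks D.kind) =
          stateValue (Matched ((triangle h hh).base ρ) A B ![1, 0, 2])
            ((triangle h hh).outerMarks D.kind) := by
      intro A B
      -- This smoothing joins the sides 1 and 2. The flat corners, on the sides 0, 2 and 1, 0, then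
      -- meet the same components, and their marks cancel.
      have t2 : Quot.mk (Tangle _ A B ![2, 0, 1] ![none, none, some false]) (.inr 2) =
          Quot.mk (Tangle _ A B ![2, 0, 1] ![none, none, some false]) (.inr 1) :=
        (Tangle.cornerJoins ((triangle h hh).base ρ) A B ![2, 0, 1] ![none, none, some false] 2).1
      rw [(triangle h hh).stateValue_unmark_corners D.kind _ (i := 0) (j := 1) (by simp) h0 h1 _
        rfl t2]
      · exact stateValue_triangle _ _ _ _ ![B 0, B 1, B 1] ![1, 0, 2] (by simp)
      · intro l hl hl'
        fin_cases l
        · exact (hl rfl).elim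
        · exact (hl' rfl).elim
        · exact h2
    rw [key, key, stateValue_matched_slide _ _ _ _ ![1, 0, 2] ![1, 0, 2] (by simp)]
  -- For the other smoothing, the side 0 joins `A 1` to `B 0` both before and after the slide, while
  -- the sides 1 and 2 exchange the arcs `B 1`–`B 2` and `A 0`–`A 2`. The flat vertices 0 and 1 are
  -- exchanged with them.
  · refine stateValue_tangle_congr
      (Equiv.swap ((triangle h hh).vert 0) ((triangle h hh).vert 1)) (Equiv.swap 1 2) ?_ ?_ ?_
    · have := Tangle.cornerJoins ((triangle h hh).base ρ)
        (fun i => (triangle h hh).B (![2, 0, 1] i)) (fun i => (triangle h hh).A (![1, 2, 0] i))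
        ![2, 0, 1] ![none, none, some true]
      have k0 := this 0
      have k1 := this 1
      have k2 := this 2
      intro i
      fin_cases i <;> simp [CornerJoins, Equiv.swap_apply_def] at k0 k1 k2 ⊢ <;> grind
    · have := Tangle.cornerJoins ((triangle h hh).base ρ) (triangle h hh).A (triangle h hh).B
        ![2, 0, 1] ![none, none, some true]
      have k0 := this 0
      have k1 := this 1
      have k2 := this 2
      intro i
      fin_cases i <;> simp [CornerJoins, Equiv.swap_apply_def] at k0 k1 k2 ⊢ <;> grind
    · have m0 : ∀ x, x ∈ (triangle h hh).marks D.kind ((triangle h hh).vert 0) ↔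
          x = .inr 0 ∨ x = .inr 2 := fun x => by
        rw [(triangle h hh).marks_vert D.kind h0]
        exact Iff.rfl
      have m1 : ∀ x, x ∈ (triangle h hh).marks D.kind ((triangle h hh).vert 1) ↔
          x = .inr 1 ∨ x = .inr 0 := fun x => by
        rw [(triangle h hh).marks_vert D.kind h1]
        exact Iff.rfl
      intro v x
      by_cases hv0 : v = (triangle h hh).vert 0
      · rw [hv0, Equiv.swap_apply_left, m0, m1]
        rcases x with k | i
        · simp
        · fin_cases i <;> simp [Equiv.swap_apply_def]
      by_cases hv1 : v = (triangle h hh).vert 1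
      · rw [hv1, Equiv.swap_apply_right, m0, m1]
        rcases x with k | i
        · simp
        · fin_cases i <;> simp [Equiv.swap_apply_def]
      rw [Equiv.swap_apply_of_ne_of_ne hv0 hv1, (triangle h hh).marks_of_ne]
      · rcases x with k | i <;> simp
      · intro i hi
        fin_cases i
        · exact hv0
        · exact hv1
        · exact (h2 hi).elim

end FlatVirtual.SurfaceDiagram

/-! ### Invariance under all moves -/

open FlatVirtual SurfaceDiagram in
theorem FlatVirtual.Move.jones_eq {D D' : Diagram} (h : Move D D') : jones D = jones D' := by
  rw [SurfaceDiagram.jones_eq, SurfaceDiagram.jones_eq]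
  change D.1.polynomial = D'.1.polynomial
  rcases h with h | h | h | h | h | h | h | h
  · obtain ⟨i⟩ := h
    exact i.polynomial_eq
  · exact ClassicalR1.polynomial_eq h
  · exact ClassicalR2.polynomial_eq h
  · exact ClassicalR3.polynomial_eq h
  · exact FlatR2.polynomial_eq h
  · exact FlatR3.polynomial_eq h
  · exact MixedR3.polynomial_eq h
  · exact Detour.polynomial_eq h

theorem theorem3 :
    (∀ D D' : FlatVirtual.Diagram,
      FlatVirtual.Move D D' → FlatVirtual.jones D = FlatVirtual.jones D') ∧
    ∃ X : FlatVirtual.Link → FlatVirtual.CoeffRing,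
      ∀ D : FlatVirtual.Diagram, X D.toLink = FlatVirtual.jones D :=
  ⟨fun _ _ h => h.jones_eq, Quot.lift FlatVirtual.jones fun _ _ h => h.jones_eq, fun _ => rfl⟩
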